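/- Let $\Psi$ be a homogeneous Poisson point process of density $\lambda>0$ in $\mathbb{R}^2$. Let each point of $\Psi$, independently of the other points and of $\Psi$, be an aggregator with probability $p\in(0,1]$ and a (transmitting) device otherwise. Let $\Psi_a$ and $\Psi_u$ be the processes of aggregators and of devices, with densities $\lambda_a=p\lambda$ and $\lambda_u=(1-p)\lambda$. Let $\alpha>0$ (path loss exponent), $\eta>0$ (power amplifier efficiency), $P_{T_{\max}}>0$ and $\bar P_T>0$. Each device transmits to its nearest aggregator, and a device at distance $d$ from it uses the transmit power $P_T(d)=\min\{P_{T_{\max}},\bar P_T d^{\alpha}\}$, for which its power amplifier consumes $P_T(d)/\eta$. For configurations $\varphi$ of aggregators with a point at the origin and $\xi$ of devices, let $V_0(\varphi)=\{x:\|x\|\le\|x-y\|\text{ for all }y\in\varphi\}$ be the Voronoi cell of the origin, and let $F(\varphi,\xi)=\sum_{x\in\xi\cap V_0(\varphi)}P_T(\|x\|)/\eta$ be the total power consumption of the power amplifiers of the devices in it. Let $\mathbb{E}^0_{\Psi_a}$ be the expectation under the Palm probability of $\Psi_a$ (the typical aggregator is at the origin), that is, for every Borel set $B\subset\mathbb{R}^2$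 of positive finite area, $$\mathbb{E}^0_{\Psi_a}[F(\Psi_a,\Psi_u)]=\frac{\mathbb{E}\sum_{z\in\Psi_a\cap B}F(\Psi_a-z,\Psi_u-z)}{\mathbb{E}[\Psi_a(B)]}.$$ Then the mean total power amplifier consumption of the devices in the Voronoi cell of the typical aggregator is finite and equals $$\mathbb{E}^0_{\Psi_a}[F(\Psi_a,\Psi_u)]=\frac{\pi\lambda_u\bar P_T}{\eta(\pi\lambda_a)^{1+\alpha/2}}\,\gamma\!\left(\frac{\alpha}{2}+1,\lambda_a\pi r_c^2\right)+\frac{\lambda_u P_{T_{\max}}}{\eta\lambda_a}e^{-\lambda_a\pi r_c^2},$$ where $r_c=(P_{T_{\max}}/\bar P_T)^{1/\alpha}$ and $\gamma(s,x)=\int_0^x t^{s-1}e^{-t}\,dt$ is the lower incomplete gamma function. -/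

import Mathlib

open MeasureTheory ProbabilityTheory

noncomputable section

/-- The Euclidean plane. -/
abbrev Plane : Type := EuclideanSpace ℝ (Fin 2)

/-- The random measure `Φ` on the plane is a homogeneous Poisson point process of density `lam`:
counts in sets of finite area are Poisson distributed with mean `lam` times the area, and counts
in disjoint sets are independent. -/
structure IsPoissonProcess {Ω : Type*} [MeasurableSpace Ω] (μ : Measure Ω)
    (Φ : Ω → Measure Plane) (lam : ℝ) : Prop where
  measurable : Measurable Φ
  count_law : ∀ B : Set Plane, MeasurableSet B → volume B ≠ ⊤ →
    μ.map (fun ω => Φ ω B) =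
      (poissonMeasure (lam * volume.real B).toNNReal).map (fun k : ℕ => (k : ENNReal))
  count_indep : ∀ (k : ℕ) (B : Fin k → Set Plane), (∀ i, MeasurableSet (B i)) →
    (∀ i, volume (B i) ≠ ⊤) → Pairwise (fun i j => Disjoint (B i) (B j)) →
    iIndepFun (fun i ω => Φ ω (B i)) μ

/-- The point process whose points are enumerated by `X`: the sum of unit masses at the `X n`. -/
def pointProcess {Ω : Type*} (X : ℕ → Ω → Plane) (ω : Ω) : Measure Plane :=
  Measure.sum fun n => Measure.dirac (X n ω)

/-- The points of the process enumerated by `X` whose mark equals `b`. -/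
def markedPart {Ω : Type*} (X : ℕ → Ω → Plane) (M : ℕ → Ω → Bool) (b : Bool) (ω : Ω) :
    Measure Plane :=
  Measure.sum fun n => if M n ω = b then Measure.dirac (X n ω) else 0

/-- The marks `M` of the points `X` define an independent thinning with probability `p`: they are
independent of each other and of the points, and each of them is `true` with probability `p`. -/
structure IsIndependentMarking {Ω : Type*} [MeasurableSpace Ω] (μ : Measure Ω)
    (X : ℕ → Ω → Plane) (M : ℕ → Ω → Bool) (p : ℝ) : Prop where
  measurable_points : ∀ n, Measurable (X n)
  measurable_marks : ∀ n, Measurable (M n)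
  prob_true : ∀ n, μ {ω | M n ω = true} = ENNReal.ofReal p
  indep_marks : iIndepFun M μ
  indep_points : IndepFun (fun ω n => X n ω) (fun ω n => M n ω) μ

/-- The configuration `φ` seen from the location `z`, that is, translated by `-z`. -/
def seenFrom (z : Plane) (φ : Measure Plane) : Measure Plane := φ.map fun y => y - z

/-- The Palm expectation, with respect to the typical point of `Φ` moved to the origin, of a
nonnegative functional `F` of two jointly stationary point processes `Φ` and `Ξ`, computed in the
window `B`: the mean sum, over the points `z` of `Φ` in `B`, of `F` of both configurations seen from
`z`, divided by the mean number of points of `Φ` in `B`. -/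
def palmExpectation {Ω : Type*} [MeasurableSpace Ω] (μ : Measure Ω)
    (Φ Ξ : Ω → Measure Plane) (B : Set Plane) (F : Measure Plane → Measure Plane → ENNReal) :
    ENNReal :=
  (∫⁻ ω, ∫⁻ z in B, F (seenFrom z (Φ ω)) (seenFrom z (Ξ ω)) ∂(Φ ω) ∂μ) / ∫⁻ ω, Φ ω B ∂μ

/-- The Voronoi cell of the location `z` with respect to the points (atoms) of `φ`. -/
def voronoiCell (φ : Measure Plane) (z : Plane) : Set Plane :=
  {x | ∀ y, φ {y} ≠ 0 → dist x z ≤ dist x y}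

/-- Transmit power at distance `d` from the receiver: channel inversion with path loss exponent `α`
and target received power `Pbar`, truncated at `Pmax`. -/
def transmitPower (α Pmax Pbar d : ℝ) : ℝ := min Pmax (Pbar * d ^ α)

/-- Power consumption of the power amplifier of efficiency `η` at distance `d` from the receiver. -/
def paPower (η α Pmax Pbar d : ℝ) : ℝ := η⁻¹ * transmitPower α Pmax Pbar d

/-- The total power amplifier consumption of the points of `ξ` (the devices) in the Voronoi cell of
the receiver at the origin with respect to `φ` (the aggregators). -/
def cellPower (η α Pmax Pbar : ℝ) (φ ξ : Measure Plane) : ENNReal :=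
  ∫⁻ x in voronoiCell φ 0, ENNReal.ofReal (paPower η α Pmax Pbar (dist x 0)) ∂ξ

/-- The lower incomplete gamma function. -/
def lowerGamma (s x : ℝ) : ℝ := ∫ t in (0 : ℝ)..x, t ^ (s - 1) * Real.exp (-t)

/-- The distance at which the transmit power reaches its maximum. -/
def criticalDistance (α Pmax Pbar : ℝ) : ℝ := (Pmax / Pbar) ^ (1 / α)

end

open Filter Topology Finset

/-! By Campbell's formula, the mean sum over aggregators in `B` is the integral of the amplifier
power against the intensity measure of pairs (aggregator `z`, device `x` in the cell of `z`). With
`a = p * lam` and `b = (1 - p) * lam`, this measure has Lebesgue density `a * b * exp (-a π |x -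
z|²)`: an aggregator at `z`, a device at `x`, and no other aggregator closer to `x`
(`servedPairMeasure_eq_withDensity`). The density depends only on `x - z`, so the integral is
proportional to the area of `B`. Dividing by the mean number of aggregators in `B` leaves a radial
integral, which is split at the critical distance.

No Palm theory and no abstract thinning theorem are used to find the density. Averaging over the
marks turns a marked product into the generating functional of the Poisson process; this gives the
joint generating function of the counts of aggregators in disjoint `C`, `E` and of devices in `D`
(`integral_pow_markedCount`). Difference quotients of it bound the mean number of pairs in `C × D`
on events about `E` (`lintegral_markedCount_mul_le`, `le_lintegral_markedCount`). When `C` and `D`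
have radius at most `δ`, service is squeezed between such events, with exclusion discs of slightly
different radii. Cutting a rectangle into small ones and letting `δ → 0` closes the gap.

Cells are closed, and a tie counts for every nearest aggregator both in the power sum and in the
pair measure, so almost sure uniqueness of the nearest aggregator is never needed. -/

/-! ### Generating function and mean of the Poisson law. -/

lemma integral_pow_poissonMeasure (r : NNReal) (s : ℝ) :
    ∫ k, s ^ k ∂(poissonMeasure r) = Real.exp (-(r * (1 - s))) := by
  rw [integral_poissonMeasure]
  have h := (NormedSpace.expSeries_div_hasSum_exp ((r : ℝ) * s)).mul_left (Real.exp (-r))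
  rw [← Real.exp_eq_exp_ℝ, ← Real.exp_add] at h
  rw [show -((r : ℝ) * (1 - s)) = -r + r * s by ring, ← h.tsum_eq]
  refine tsum_congr fun n => ?_
  rw [smul_eq_mul, mul_pow]; ring

lemma lintegral_cast_poissonMeasure (r : NNReal) :
    ∫⁻ k, (k : ENNReal) ∂(poissonMeasure r) = r := by
  rw [poissonMeasure, lintegral_sum_measure]
  simp_rw [lintegral_smul_measure, lintegral_dirac, smul_eq_mul]
  have h : HasSum (fun n : ℕ => Real.exp (-r) * (r : ℝ) ^ n / n.factorial * n) r := by
    -- Drop the vanishing term at `0`: the term at `n + 1` is `r` times the Poisson weight of `n`.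
    rw [← hasSum_nat_add_iff' 1]
    have h := (hasSum_one_poissonMeasure r).mul_left (r : ℝ)
    simp only [mul_one, sum_range_one, Nat.cast_zero, mul_zero, sub_zero] at h ⊢
    refine h.congr_fun fun n => ?_
    rw [Nat.factorial_succ]
    push_cast
    rw [pow_succ]
    field_simp
  have h2 : ∀ n : ℕ, ENNReal.ofReal (Real.exp (-r) * (r : ℝ) ^ n / n.factorial) * n =
      ENNReal.ofReal (Real.exp (-r) * (r : ℝ) ^ n / n.factorial * n) := fun n => by
    rw [ENNReal.ofReal_mul (by positivity), ENNReal.ofReal_natCast]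
  simp_rw [h2]
  rw [← ENNReal.ofReal_tsum_of_nonneg (fun n => by positivity) h.summable, h.tsum_eq]
  simp

/-! ### Counts of an enumerated point process. -/

section Counting

lemma pointProcess_apply {Ω : Type*} (X : ℕ → Ω → Plane) (ω : Ω) {B : Set Plane}
    (hB : MeasurableSet B) :
    pointProcess X ω B = ∑' n, B.indicator 1 (X n ω) := by
  rw [pointProcess, Measure.sum_apply _ hB]
  simp [Measure.dirac_apply' _ hB]

lemma tsum_indicator_eq_encard {ι E : Type*} (x : ι → E) (B : Set E) :
    ∑' n, B.indicator (1 : E → ENNReal) (x n) = ({n | x n ∈ B}.encard : ENNReal) := by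
  rw [← ENNReal.tsum_set_one]
  exact (_root_.tsum_subtype {n | x n ∈ B} (fun _ => (1 : ENNReal))).symm

lemma finite_of_pointProcess_ne_top {Ω : Type*} (X : ℕ → Ω → Plane) (ω : Ω) {B : Set Plane}
    (hB : MeasurableSet B) (h : pointProcess X ω B ≠ ⊤) : {n | X n ω ∈ B}.Finite := by
  rw [pointProcess_apply X ω hB, tsum_indicator_eq_encard] at h
  rw [← Set.encard_ne_top_iff]
  simpa using h

lemma pointProcess_eq_ncard {Ω : Type*} (X : ℕ → Ω → Plane) (ω : Ω) {B : Set Plane}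
    (hB : MeasurableSet B) (h : {n | X n ω ∈ B}.Finite) :
    pointProcess X ω B = ({n | X n ω ∈ B}.ncard : ENNReal) := by
  rw [pointProcess_apply X ω hB, tsum_indicator_eq_encard, ← h.cast_ncard_eq]
  simp

end Counting

/-! ### Generating functional of a Poisson process. -/

namespace IsPoissonProcess

variable {Ω : Type*} [MeasurableSpace Ω] {μ : Measure Ω} {Φ : Ω → Measure Plane} {lam : ℝ}

lemma measurable_count (hΦ : IsPoissonProcess μ Φ lam) {B : Set Plane} (hB : MeasurableSet B) :
    Measurable fun ω => Φ ω B :=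
  (Measure.measurable_coe hB).comp hΦ.measurable

lemma ae_ne_top (hΦ : IsPoissonProcess μ Φ lam) {B : Set Plane} (hB : MeasurableSet B)
    (hv : volume B ≠ ⊤) : ∀ᵐ ω ∂μ, Φ ω B ≠ ⊤ := by
  have h := hΦ.count_law B hB hv
  have hm : MeasurableSet {t : ENNReal | t = ⊤} := measurableSet_singleton _
  have h2 : (μ.map (fun ω => Φ ω B)) {t | t = ⊤} = 0 := by
    rw [h, Measure.map_apply .of_discrete hm]
    convert measure_empty (μ := poissonMeasure (lam * volume.real B).toNNReal)
    ext k
    simp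
  rw [Measure.map_apply (hΦ.measurable_count hB) hm] at h2
  rw [ae_iff]
  simp only [ne_eq, not_not]
  exact h2

lemma lintegral_count (hΦ : IsPoissonProcess μ Φ lam) (hlam : 0 ≤ lam) {B : Set Plane}
    (hB : MeasurableSet B) (hv : volume B ≠ ⊤) :
    ∫⁻ ω, Φ ω B ∂μ = ENNReal.ofReal lam * volume B := by
  have h : ∫⁻ t, t ∂(μ.map (fun ω => Φ ω B)) = ENNReal.ofReal lam * volume B := by
    rw [hΦ.count_law B hB hv, lintegral_map (f := fun t => t) measurable_id .of_discrete,
      lintegral_cast_poissonMeasure]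
    change ENNReal.ofReal (lam * volume.real B) = _
    rw [ENNReal.ofReal_mul hlam, ofReal_measureReal hv]
  rwa [lintegral_map (f := fun t => t) measurable_id (hΦ.measurable_count hB)] at h

/-- The floor of `toReal` turns an extended count into an exponent; the junk value at `⊤` is
harmless because counts in sets of finite area are almost surely finite. -/
lemma measurable_pow_floor (s : ℝ) : Measurable fun t : ENNReal => s ^ ⌊t.toReal⌋₊ :=
  (Measurable.of_discrete (f := fun k : ℕ => s ^ k)).comp
    (Nat.measurable_floor.comp ENNReal.measurable_toReal)

lemma integral_pow_count (hΦ : IsPoissonProcess μ Φ lam) (hlam : 0 ≤ lam) {B : Set Plane}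
    (hB : MeasurableSet B) (hv : volume B ≠ ⊤) (s : ℝ) :
    ∫ ω, s ^ ⌊(Φ ω B).toReal⌋₊ ∂μ = Real.exp (-(lam * volume.real B * (1 - s))) := by
  have h : ∫ t, s ^ ⌊t.toReal⌋₊ ∂(μ.map (fun ω => Φ ω B)) =
      Real.exp (-(lam * volume.real B * (1 - s))) := by
    rw [hΦ.count_law B hB hv, integral_map .of_discrete
      (measurable_pow_floor s).aestronglyMeasurable]
    simp only [ENNReal.toReal_natCast, Nat.floor_natCast]
    rw [integral_pow_poissonMeasure, Real.coe_toNNReal _ (by positivity)]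
  rwa [integral_map (hΦ.measurable_count hB).aemeasurable
    (measurable_pow_floor s).aestronglyMeasurable] at h

lemma integral_prod_pow_count (hΦ : IsPoissonProcess μ Φ lam) (hlam : 0 ≤ lam)
    {ι : Type*} (R : Finset ι) (B : ι → Set Plane) (hB : ∀ i, MeasurableSet (B i))
    (hv : ∀ i ∈ R, volume (B i) ≠ ⊤) (hd : Pairwise fun i j => Disjoint (B i) (B j))
    (s : ι → ℝ) :
    ∫ ω, ∏ i ∈ R, s i ^ ⌊(Φ ω (B i)).toReal⌋₊ ∂μ =
      Real.exp (-(lam * ∑ i ∈ R, volume.real (B i) * (1 - s i))) := by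
  -- `count_indep` is stated for families indexed by `Fin k`.
  have e := R.equivFin.symm
  have hprod : ∀ f : ι → ℝ, ∏ i ∈ R, f i = ∏ j, f (e j) := fun f => by
    rw [← Finset.prod_coe_sort]
    exact (Equiv.prod_comp e (fun i : R => f i)).symm
  have hind := hΦ.count_indep R.card (fun j => B (e j)) (fun j => hB _)
    (fun j => hv _ (e j).2)
    (fun i j hij => hd fun h => hij (e.injective (Subtype.ext h)))
  simp_rw [hprod]
  rw [hind.integral_fun_prod_comp (f := fun j t => s (e j) ^ ⌊t.toReal⌋₊)
    (fun j => (hΦ.measurable_count (hB _)).aemeasurable)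
    (fun j => (measurable_pow_floor _).aestronglyMeasurable)]
  have : ∀ j, ∫ ω, s (e j) ^ ⌊(Φ ω (B (e j))).toReal⌋₊ ∂μ =
      Real.exp (-(lam * volume.real (B (e j)) * (1 - s (e j)))) :=
    fun j => hΦ.integral_pow_count hlam (hB _) (hv _ (e j).2) _
  rw [Finset.prod_congr rfl fun j _ => this j, mul_sum, ← sum_neg_distrib, Real.exp_sum, hprod]
  simp_rw [mul_assoc]

/-- The probability generating functional of a Poisson process, for functions with finitely many
values that differ from `1` on a set of finite area only. -/
lemma tendsto_integral_prod {X : ℕ → Ω → Plane} [IsProbabilityMeasure μ]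
    (hX : IsPoissonProcess μ (pointProcess X) lam)
    (hm : ∀ n, Measurable (X n)) (hlam : 0 ≤ lam) {w : Plane → ℝ} (hw : Measurable w)
    (hfin : (Set.range w).Finite) (h0 : ∀ x, 0 ≤ w x) (h1 : ∀ x, w x ≤ 1)
    (hv : volume {x | w x ≠ 1} ≠ ⊤) :
    Tendsto (fun K => ∫ ω, ∏ n ∈ range K, w (X n ω) ∂μ) atTop
      (𝓝 (Real.exp (-(lam * ∫ x, (1 - w x))))) := by
  classical
  -- The value `1` is removed: its level set may have infinite area, and its points contribute
  -- trivial factors.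
  set R : Finset ℝ := hfin.toFinset.erase 1 with hR
  have hBm : ∀ c : ℝ, MeasurableSet (w ⁻¹' {c}) := fun c => hw (measurableSet_singleton c)
  have hwm : MeasurableSet {x | w x ≠ 1} := (hBm 1).compl
  have hBv : ∀ c ∈ R, volume (w ⁻¹' {c}) ≠ ⊤ := fun c hc =>
    measure_ne_top_of_subset (fun x (hx : w x = c) => by
      rw [Set.mem_ofPred_eq, hx]; exact (Finset.mem_erase.1 hc).1) hv
  have hd : Pairwise fun c d : ℝ => Disjoint (w ⁻¹' {c}) (w ⁻¹' {d}) := fun c d hcd =>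
    Disjoint.preimage _ (by simpa using hcd)
  have hint : ∫ x, (1 - w x) = ∑ c ∈ R, volume.real (w ⁻¹' {c}) * (1 - c) := by
    have heq : ∀ x, 1 - w x = ∑ c ∈ R, (w ⁻¹' {c}).indicator (fun _ => 1 - c) x := fun x => by
      simp only [Set.indicator_apply, Set.mem_preimage, Set.mem_singleton_iff]
      rw [Finset.sum_ite_eq]
      split_ifs with h
      · rfl
      · have : w x = 1 := by simpa [hR] using h
        simp [this]
    simp_rw [heq]
    rw [integral_finsetSum]
    · refine sum_congr rfl fun c hc => ?_
      rw [integral_indicator (hBm c), setIntegral_const, smul_eq_mul]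
    · intro c hc
      rw [integrable_indicator_iff (hBm c)]
      exact integrableOn_const (hBv c hc)
  rw [hint, ← hX.integral_prod_pow_count hlam R (fun c => w ⁻¹' {c}) hBm hBv hd (fun c => c)]
  -- Partial products lie in `[0, 1]` and are almost surely eventually constant, as only finitely
  -- many points fall where `w ≠ 1`.
  refine tendsto_integral_of_dominated_convergence (fun _ => 1) ?_ (integrable_const _) ?_ ?_
  · intro K
    exact (Finset.measurable_prod _ fun n _ => hw.comp (hm n)).aestronglyMeasurable
  · refine fun K => ae_of_all _ fun ω => ?_
    rw [Real.norm_eq_abs, abs_of_nonneg (prod_nonneg fun n _ => h0 _)]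
    exact prod_le_one (fun n _ => h0 _) fun n _ => h1 _
  · filter_upwards [hX.ae_ne_top hwm hv] with ω hω
    have hS := finite_of_pointProcess_ne_top X ω hwm hω
    have hlim : ∏ c ∈ R, c ^ ⌊(pointProcess X ω (w ⁻¹' {c})).toReal⌋₊ =
        ∏ n ∈ hS.toFinset, w (X n ω) := by
      rw [← Finset.prod_fiberwise_of_maps_to (t := R) (g := fun n => w (X n ω))]
      · refine prod_congr rfl fun c hc => ?_
        have hsub : {n | X n ω ∈ w ⁻¹' {c}} ⊆ {n | X n ω ∈ {x | w x ≠ 1}} :=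
          fun n (hn : w (X n ω) = c) => by
            change w (X n ω) ≠ 1
            rw [hn]; exact (Finset.mem_erase.1 hc).1
        rw [pointProcess_eq_ncard X ω (hBm c) (hS.subset hsub)]
        simp only [ENNReal.toReal_natCast, Nat.floor_natCast]
        rw [prod_congr rfl (g := fun _ => c) fun n hn => (mem_filter.1 hn).2, prod_const,
          ← Set.ncard_coe_finset]
        congr 2
        ext n
        simp only [Set.mem_ofPred_eq, coe_filter, Set.Finite.mem_toFinset, Set.mem_preimage,
          Set.mem_singleton_iff]
        exact ⟨fun h => ⟨hsub h, h⟩, fun h => h.2⟩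
      · intro n hn
        simpa [hR] using hn
    rw [hlim]
    refine tendsto_const_nhds.congr' ?_
    obtain ⟨N, hN⟩ := hS.bddAbove
    filter_upwards [eventually_gt_atTop N] with K hK
    refine prod_subset (fun n hn => ?_) fun n _ hn => ?_
    · rw [Finset.mem_range]
      exact (hN (hS.mem_toFinset.1 hn)).trans_lt hK
    · simpa using hn

end IsPoissonProcess

/-! ### Independent thinning and its joint generating function. -/

/-- The number of points in `B` whose mark is `b` (zero if it is infinite). -/
noncomputable def markedCount {Ω : Type*} (X : ℕ → Ω → Plane) (M : ℕ → Ω → Bool) (b : Bool)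
    (B : Set Plane) (ω : Ω) : ℕ :=
  {n | M n ω = b ∧ X n ω ∈ B}.ncard

lemma markedPart_eq_encard {Ω : Type*} (X : ℕ → Ω → Plane) (M : ℕ → Ω → Bool) (b : Bool) (ω : Ω)
    {B : Set Plane} (hB : MeasurableSet B) :
    markedPart X M b ω B = ({n | M n ω = b ∧ X n ω ∈ B}.encard : ENNReal) := by
  classical
  rw [markedPart, Measure.sum_apply _ hB, ← ENNReal.tsum_set_one,
    _root_.tsum_subtype {n | M n ω = b ∧ X n ω ∈ B} (fun _ => (1 : ENNReal))]
  refine tsum_congr fun n => ?_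
  by_cases h : M n ω = b <;> by_cases h' : X n ω ∈ B <;>
    simp [h, h', Measure.dirac_apply' _ hB]

/-- The conventions agree on infinite sets: `ncard` and `toReal` of `⊤` are both zero. Measurability
of `markedCount` is read off from this form. -/
lemma markedCount_eq_floor {Ω : Type*} (X : ℕ → Ω → Plane) (M : ℕ → Ω → Bool) (b : Bool) (ω : Ω)
    {B : Set Plane} (hB : MeasurableSet B) :
    markedCount X M b B ω = ⌊(markedPart X M b ω B).toReal⌋₊ := by
  rw [markedPart_eq_encard X M b ω hB, markedCount]
  rcases Set.finite_or_infinite {n | M n ω = b ∧ X n ω ∈ B} with h | h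
  · rw [← h.cast_ncard_eq]; simp
  · rw [h.encard_eq, h.ncard]; simp

lemma eventually_card_filter_range {P : ℕ → Prop} [DecidablePred P] (h : {n | P n}.Finite) :
    ∀ᶠ K in atTop, #{n ∈ range K | P n} = {n | P n}.ncard := by
  obtain ⟨N, hN⟩ := h.bddAbove
  filter_upwards [eventually_gt_atTop N] with K hK
  rw [← Set.ncard_coe_finset]
  congr 1
  ext n
  simp only [coe_filter, Finset.mem_range, Set.mem_ofPred_eq]
  exact ⟨fun h => h.2, fun h => ⟨(hN h).trans_lt hK, h⟩⟩

namespace IsIndependentMarking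

variable {Ω : Type*} [MeasurableSpace Ω] {μ : Measure Ω}
  {X : ℕ → Ω → Plane} {M : ℕ → Ω → Bool} {p : ℝ}

lemma measurable_markedPart (hM : IsIndependentMarking μ X M p) (b : Bool) {B : Set Plane}
    (hB : MeasurableSet B) : Measurable fun ω => markedPart X M b ω B := by
  have : ∀ ω, markedPart X M b ω B =
      ∑' n, {ω | M n ω = b ∧ X n ω ∈ B}.indicator (1 : Ω → ENNReal) ω := fun ω => by
    rw [markedPart, Measure.sum_apply _ hB]
    refine tsum_congr fun n => ?_
    by_cases h : M n ω = b <;> by_cases h' : X n ω ∈ B <;>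
      simp [h, h', Measure.dirac_apply' _ hB]
  simp_rw [this]
  refine Measurable.tsum fun n => measurable_one.indicator ?_
  exact ((hM.measurable_marks n) (measurableSet_singleton b)).inter (hM.measurable_points n hB)

lemma measurable_markedCount (hM : IsIndependentMarking μ X M p) (b : Bool) {B : Set Plane}
    (hB : MeasurableSet B) : Measurable (markedCount X M b B) := by
  have : markedCount X M b B = fun ω => ⌊(markedPart X M b ω B).toReal⌋₊ :=
    funext fun ω => markedCount_eq_floor X M b ω hB
  rw [this]
  exact Nat.measurable_floor.comp (ENNReal.measurable_toReal.comp (hM.measurable_markedPart b hB))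

/-- The mean number of retained points of an independently thinned Poisson process. -/
lemma lintegral_markedPart {lam : ℝ} (hM : IsIndependentMarking μ X M p)
    (hX : IsPoissonProcess μ (pointProcess X) lam) (hlam : 0 ≤ lam)
    {B : Set Plane} (hB : MeasurableSet B) (hBv : volume B ≠ ⊤) :
    ∫⁻ ω, markedPart X M true ω B ∂μ = ENNReal.ofReal p * (ENNReal.ofReal lam * volume B) := by
  rw [← hX.lintegral_count hlam hB hBv]
  have hind : ∀ n, IndepFun (X n) (M n) μ := fun n =>
    hM.indep_points.comp (φ := fun x : ℕ → Plane => x n) (ψ := fun m : ℕ → Bool => m n) (measurable_pi_apply n)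
      (measurable_pi_apply n)
  have h1 : ∀ ω, markedPart X M true ω B =
      ∑' n, {ω | X n ω ∈ B ∧ M n ω = true}.indicator (1 : Ω → ENNReal) ω := fun ω => by
    rw [markedPart, Measure.sum_apply _ hB]
    refine tsum_congr fun n => ?_
    by_cases h : M n ω = true <;> by_cases h' : X n ω ∈ B <;>
      simp [h, h', Measure.dirac_apply' _ hB]
  have h2 : ∀ ω, pointProcess X ω B =
      ∑' n, {ω | X n ω ∈ B}.indicator (1 : Ω → ENNReal) ω := fun ω => by
    rw [pointProcess_apply X ω hB]; rfl
  have hXB : ∀ n, MeasurableSet {ω | X n ω ∈ B} := fun n => hM.measurable_points n hB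
  have hXM : ∀ n, MeasurableSet {ω | X n ω ∈ B ∧ M n ω = true} := fun n =>
    (hXB n).inter (hM.measurable_marks n (measurableSet_singleton true))
  simp_rw [h1, h2]
  rw [lintegral_tsum fun n => (measurable_one.indicator (hXM n)).aemeasurable,
    lintegral_tsum fun n => (measurable_one.indicator (hXB n)).aemeasurable, ← ENNReal.tsum_mul_left]
  refine tsum_congr fun n => ?_
  rw [lintegral_indicator_one (hXM n), lintegral_indicator_one (hXB n), ← hM.prob_true n, mul_comm]
  exact (hind n).measure_inter_preimage_eq_mul B {true} hB (measurableSet_singleton true)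

variable [IsProbabilityMeasure μ]

lemma integral_mark (hM : IsIndependentMarking μ X M p) (hp : 0 ≤ p) (n : ℕ) (a b : ℝ) :
    ∫ ω, (if M n ω = true then a else b) ∂μ = p * a + (1 - p) * b := by
  have hs : MeasurableSet {ω | M n ω = true} := hM.measurable_marks n (measurableSet_singleton true)
  have hr : μ.real {ω | M n ω = true} = p := by
    rw [measureReal_def, hM.prob_true n, ENNReal.toReal_ofReal hp]
  have : ∀ ω, (if M n ω = true then a else b) =
      {ω | M n ω = true}.indicator (fun _ => a - b) ω + b := fun ω => by
    by_cases h : M n ω = true <;> simp [h]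
  simp_rw [this]
  rw [integral_add ((integrable_const _).indicator hs) (integrable_const _), integral_indicator hs,
    setIntegral_const, hr]
  simp
  ring

/-- Fubini: with the points frozen, the marks are independent and each factor averages separately.
The result involves the unmarked process only. -/
lemma integral_prod_marked (hM : IsIndependentMarking μ X M p) (hp : 0 ≤ p)
    {u v : Plane → ℝ} (hu : Measurable u) (hv : Measurable v)
    (hu0 : ∀ x, 0 ≤ u x) (hu1 : ∀ x, u x ≤ 1) (hv0 : ∀ x, 0 ≤ v x) (hv1 : ∀ x, v x ≤ 1) (K : ℕ) :
    ∫ ω, ∏ n ∈ range K, (if M n ω = true then u (X n ω) else v (X n ω)) ∂μ =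
      ∫ ω, ∏ n ∈ range K, (p * u (X n ω) + (1 - p) * v (X n ω)) ∂μ := by
  set F : (ℕ → Plane) × (ℕ → Bool) → ℝ :=
    fun q => ∏ n ∈ range K, (if q.2 n = true then u (q.1 n) else v (q.1 n)) with hF
  have hFm : Measurable F := by
    refine Finset.measurable_prod _ fun n _ => Measurable.ite ?_ ?_ ?_
    · have h2 : Measurable fun q : (ℕ → Plane) × (ℕ → Bool) => q.2 n :=
        (measurable_pi_apply n).comp measurable_snd
      exact h2 (measurableSet_singleton true)
    · exact hu.comp ((measurable_pi_apply n).comp measurable_fst)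
    · exact hv.comp ((measurable_pi_apply n).comp measurable_fst)
  have hXm : Measurable fun ω n => X n ω := measurable_pi_lambda _ hM.measurable_points
  have hMm : Measurable fun ω n => M n ω := measurable_pi_lambda _ hM.measurable_marks
  have hmap := (indepFun_iff_map_prod_eq_prod_map_map hXm.aemeasurable hMm.aemeasurable).1
    hM.indep_points
  have h1 : ∫ ω, F (fun n => X n ω, fun n => M n ω) ∂μ =
      ∫ q, F q ∂(μ.map fun ω => ((fun n => X n ω), (fun n => M n ω))) := by
    rw [integral_map (hXm.prodMk hMm).aemeasurable hFm.aestronglyMeasurable]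
  have := Measure.isProbabilityMeasure_map (μ := μ) hXm.aemeasurable
  have := Measure.isProbabilityMeasure_map (μ := μ) hMm.aemeasurable
  have hFi : Integrable F ((μ.map fun ω n => X n ω).prod (μ.map fun ω n => M n ω)) := by
    refine Integrable.of_bound hFm.aestronglyMeasurable 1 (ae_of_all _ fun q => ?_)
    rw [Real.norm_eq_abs, abs_of_nonneg]
    · exact prod_le_one (fun n _ => by split_ifs <;> simp [*]) fun n _ => by split_ifs <;> simp [*]
    · exact prod_nonneg fun n _ => by split_ifs <;> simp [*]
  have hinner : ∀ x : ℕ → Plane, ∫ m, F (x, m) ∂(μ.map fun ω n => M n ω) =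
      ∏ n ∈ range K, (p * u (x n) + (1 - p) * v (x n)) := fun x => by
    have hFx : Measurable fun m => F (x, m) := hFm.comp measurable_prodMk_left
    rw [integral_map hMm.aemeasurable hFx.aestronglyMeasurable]
    simp only [hF, Finset.prod_range]
    have hind : iIndepFun (fun i : Fin K => M i) μ :=
      hM.indep_marks.precomp Fin.val_injective
    rw [hind.integral_fun_prod_comp
      (f := fun (i : Fin K) (b : Bool) => if b = true then u (x i) else v (x i))
      (fun i => (hM.measurable_marks i).aemeasurable)
      (fun i => Measurable.of_discrete.aestronglyMeasurable)]
    exact prod_congr rfl fun i _ => hM.integral_mark hp i _ _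
  calc _ = ∫ ω, F (fun n => X n ω, fun n => M n ω) ∂μ := rfl
    _ = _ := by
      rw [h1, hmap, integral_prod _ hFi]
      simp_rw [hinner]
      rw [integral_map hXm.aemeasurable]
      refine (Finset.measurable_prod _ fun n _ => ?_).aestronglyMeasurable
      exact ((hu.comp (measurable_pi_apply n)).const_mul _).add
        ((hv.comp (measurable_pi_apply n)).const_mul _)

/-- The joint probability generating function of the numbers of points of an independently thinned
Poisson process: retained points in the disjoint sets `C` and `E`, deleted ones in `D`. -/
lemma integral_pow_markedCount {lam : ℝ} (hM : IsIndependentMarking μ X M p)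
    (hX : IsPoissonProcess μ (pointProcess X) lam) (hlam : 0 ≤ lam) (hp : 0 ≤ p) (hp1 : p ≤ 1)
    {C E D : Set Plane} (hC : MeasurableSet C) (hE : MeasurableSet E) (hD : MeasurableSet D)
    (hCv : volume C ≠ ⊤) (hEv : volume E ≠ ⊤) (hDv : volume D ≠ ⊤) (hCE : Disjoint C E)
    {s r t : ℝ} (hs0 : 0 ≤ s) (hs1 : s ≤ 1) (hr0 : 0 ≤ r) (hr1 : r ≤ 1) (ht0 : 0 ≤ t)
    (ht1 : t ≤ 1) :
    ∫ ω, s ^ markedCount X M true C ω * r ^ markedCount X M true E ω *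
        t ^ markedCount X M false D ω ∂μ =
      Real.exp (-(p * lam * volume.real C * (1 - s) + p * lam * volume.real E * (1 - r) +
        (1 - p) * lam * volume.real D * (1 - t))) := by
  classical
  -- A retained point contributes the factor `u`, a deleted one `v`. The set `D` may meet `C` and
  -- `E`, since the marks already separate the two kinds.
  set u : Plane → ℝ := fun x => (if x ∈ C then s else 1) * (if x ∈ E then r else 1) with hu
  set v : Plane → ℝ := fun x => if x ∈ D then t else 1 with hv
  have hum : Measurable u := (Measurable.ite hC measurable_const measurable_const).mul
    (Measurable.ite hE measurable_const measurable_const)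
  have hvm : Measurable v := Measurable.ite hD measurable_const measurable_const
  have hu0 : ∀ x, 0 ≤ u x := fun x => by
    simp only [hu]; split_ifs <;> positivity
  have hu1 : ∀ x, u x ≤ 1 := fun x => by
    simp only [hu]
    exact mul_le_one₀ (by split_ifs <;> simp [*]) (by split_ifs <;> simp [*])
      (by split_ifs <;> simp [*])
  have hv0 : ∀ x, 0 ≤ v x := fun x => by simp only [hv]; split_ifs <;> positivity
  have hv1 : ∀ x, v x ≤ 1 := fun x => by simp only [hv]; split_ifs <;> simp [*]
  have hU : MeasurableSet (C ∪ E ∪ D) := (hC.union hE).union hD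
  have hUv : volume (C ∪ E ∪ D) ≠ ⊤ :=
    measure_union_ne_top (measure_union_ne_top hCv hEv) hDv
  have hrange : (Set.range fun x => p * u x + (1 - p) * v x).Finite := by
    have : (Set.range fun x => p * u x + (1 - p) * v x) ⊆
        (fun q : Bool × Bool × Bool => p * ((if q.1 then s else 1) * (if q.2.1 then r else 1)) +
          (1 - p) * (if q.2.2 then t else 1)) '' Set.univ := by
      rintro _ ⟨x, rfl⟩
      exact ⟨(decide (x ∈ C), decide (x ∈ E), decide (x ∈ D)), trivial, by simp [hu, hv]⟩
    exact (Set.finite_univ.image _).subset this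
  have hne : {x | p * u x + (1 - p) * v x ≠ 1} ⊆ C ∪ E ∪ D := by
    intro x hx
    by_contra hc
    simp only [Set.mem_union, not_or] at hc
    exact hx (by simp [hu, hv, hc.1.1, hc.1.2, hc.2])
  have hlim := hX.tendsto_integral_prod (w := fun x => p * u x + (1 - p) * v x) hM.measurable_points hlam
    ((hum.const_mul p).add (hvm.const_mul (1 - p))) hrange
    (fun x => add_nonneg (mul_nonneg hp (hu0 x)) (mul_nonneg (sub_nonneg.2 hp1) (hv0 x)))
    (fun x => by nlinarith [hu1 x, hv1 x])
    (measure_ne_top_of_subset hne hUv)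
  have hint : ∫ x, (1 - (p * u x + (1 - p) * v x)) =
      p * (volume.real C * (1 - s)) + p * (volume.real E * (1 - r)) +
        (1 - p) * (volume.real D * (1 - t)) := by
    have heq : ∀ x, 1 - (p * u x + (1 - p) * v x) =
        C.indicator (fun _ => p * (1 - s)) x + E.indicator (fun _ => p * (1 - r)) x +
          D.indicator (fun _ => (1 - p) * (1 - t)) x := fun x => by
      have hx : ¬ (x ∈ C ∧ x ∈ E) := fun h => Set.disjoint_left.1 hCE h.1 h.2
      by_cases h1 : x ∈ C <;> by_cases h2 : x ∈ E <;> by_cases h3 : x ∈ D <;>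
        simp [hu, hv, h1, h2, h3] at hx ⊢ <;> ring
    have hi : ∀ {A : Set Plane} (c : ℝ), MeasurableSet A → volume A ≠ ⊤ →
        Integrable (A.indicator fun _ => c) := fun c hA hAv => by
      rw [integrable_indicator_iff hA]; exact integrableOn_const hAv
    simp_rw [heq]
    rw [integral_add (f := fun x => C.indicator (fun _ => p * (1 - s)) x +
        E.indicator (fun _ => p * (1 - r)) x) ((hi _ hC hCv).add (hi _ hE hEv)) (hi _ hD hDv),
      integral_add (hi _ hC hCv) (hi _ hE hEv), integral_indicator hC, integral_indicator hE,
      integral_indicator hD]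
    simp only [setIntegral_const, smul_eq_mul]
    ring
  rw [hint] at hlim
  simp_rw [← hM.integral_prod_marked hp hum hvm hu0 hu1 hv0 hv1] at hlim
  have hlim2 : Tendsto (fun K => ∫ ω, ∏ n ∈ range K,
      (if M n ω = true then u (X n ω) else v (X n ω)) ∂μ) atTop
      (𝓝 (∫ ω, s ^ markedCount X M true C ω * r ^ markedCount X M true E ω *
        t ^ markedCount X M false D ω ∂μ)) := by
    refine tendsto_integral_of_dominated_convergence (fun _ => 1) ?_ (integrable_const _) ?_ ?_
    · refine fun K => (Finset.measurable_prod _ fun n _ => ?_).aestronglyMeasurable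
      exact Measurable.ite (hM.measurable_marks n (measurableSet_singleton true))
        (hum.comp (hM.measurable_points n)) (hvm.comp (hM.measurable_points n))
    · refine fun K => ae_of_all _ fun ω => ?_
      rw [Real.norm_eq_abs, abs_of_nonneg]
      · exact prod_le_one (fun n _ => by split_ifs; exacts [hu0 _, hv0 _])
          fun n _ => by split_ifs; exacts [hu1 _, hv1 _]
      · exact prod_nonneg fun n _ => by split_ifs; exacts [hu0 _, hv0 _]
    · filter_upwards [hX.ae_ne_top hU hUv] with ω hω
      have hS := finite_of_pointProcess_ne_top X ω hU hω
      refine tendsto_const_nhds.congr' ?_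
      have e1 := eventually_card_filter_range (P := fun n => M n ω = true ∧ X n ω ∈ C)
        (hS.subset fun n hn => Or.inl (Or.inl hn.2))
      have e2 := eventually_card_filter_range (P := fun n => M n ω = true ∧ X n ω ∈ E)
        (hS.subset fun n hn => Or.inl (Or.inr hn.2))
      have e3 := eventually_card_filter_range (P := fun n => M n ω = false ∧ X n ω ∈ D)
        (hS.subset fun n hn => Or.inr hn.2)
      filter_upwards [e1, e2, e3] with K h1 h2 h3
      rw [markedCount, markedCount, markedCount, ← h1, ← h2, ← h3]
      rw [← prod_const, ← prod_const, ← prod_const, prod_filter, prod_filter, prod_filter,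
        ← prod_mul_distrib, ← prod_mul_distrib]
      refine prod_congr rfl fun n _ => ?_
      by_cases hm : M n ω = true
      · simp [hm, hu]
      · rw [Bool.not_eq_true] at hm
        simp [hm, hv]
  -- The same sequence of integrals converges to the generating function and to the Poisson
  -- exponential.
  rw [tendsto_nhds_unique hlim2 hlim]
  congr 1
  ring

end IsIndependentMarking

/-! ### Difference quotients of generating functions. -/

lemma tendsto_one_sub_exp_div (a : ℝ) :
    Tendsto (fun h => (1 - Real.exp (-(a * h))) / h) (𝓝[>] 0) (𝓝 a) := by
  have h1 : HasDerivAt (fun h => 1 - Real.exp (-(a * h))) a 0 := by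
    have := ((((hasDerivAt_id (0 : ℝ)).const_mul a).neg).exp).const_sub 1
    simpa using this
  have h2 := h1.tendsto_slope.mono_left (nhdsWithin_mono _ fun x (hx : 0 < x) => hx.ne')
  refine h2.congr fun h => ?_
  simp [slope_def_field]

lemma one_sub_pow_div_eq_sum {t : ℝ} (ht : t ≠ 1) (N : ℕ) :
    (1 - t ^ N) / (1 - t) = ∑ i ∈ range N, t ^ i := by
  rw [geom_sum_eq ht, ← neg_sub (t ^ N), ← neg_sub t, neg_div_neg_eq]

lemma one_sub_pow_div_le {t : ℝ} (ht0 : 0 ≤ t) (ht1 : t < 1) (N : ℕ) :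
    (1 - t ^ N) / (1 - t) ≤ N := by
  rw [one_sub_pow_div_eq_sum ht1.ne]
  calc ∑ i ∈ range N, t ^ i ≤ ∑ i ∈ range N, (1 : ℝ) :=
        sum_le_sum fun i _ => pow_le_one₀ ht0 ht1.le
    _ = N := by simp

lemma tendsto_one_sub_pow_div (N : ℕ) :
    Tendsto (fun h : ℝ => (1 - (1 - h) ^ N) / h) (𝓝[>] 0) (𝓝 N) := by
  have h1 : Continuous fun h : ℝ => ∑ i ∈ range N, (1 - h) ^ i := by fun_prop
  have h2 := (h1.tendsto 0).mono_left (nhdsWithin_le_nhds (s := Set.Ioi 0))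
  simp only [sub_zero, one_pow, sum_const, card_range, nsmul_eq_mul, mul_one] at h2
  refine h2.congr' ?_
  filter_upwards [self_mem_nhdsWithin] with h (hh : 0 < h)
  rw [← one_sub_pow_div_eq_sum (by linarith)]
  simp

/-- For `N ≥ 1` the quotient is `s ^ (N - 1)`, at most `s` once `N ≥ 2`; subtracting `s` therefore
gives a minorant of the indicator of `N = 1` that is a combination of powers. -/
lemma pow_sub_zero_pow_div_le {s : ℝ} (hs0 : 0 < s) (hs1 : s ≤ 1) (N : ℕ) :
    (s ^ N - 0 ^ N) / s - s ≤ if N = 1 then 1 else 0 := by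
  rcases N with _ | _ | N
  · simpa using hs0.le
  · simp [hs0.ne', hs0.le]
  · have : (s ^ (N + 1 + 1) - 0 ^ (N + 1 + 1)) / s = s * s ^ N := by
      rw [zero_pow (by omega)]; field_simp; ring
    rw [this, if_neg (by omega)]
    nlinarith [pow_le_one₀ hs0.le hs1 (n := N)]

lemma ofReal_integral_le_lintegral_ofReal {Ω : Type*} [MeasurableSpace Ω] {μ : Measure Ω}
    {f : Ω → ℝ} (hf : Integrable f μ) :
    ENNReal.ofReal (∫ ω, f ω ∂μ) ≤ ∫⁻ ω, ENNReal.ofReal (f ω) ∂μ := by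
  refine ENNReal.ofReal_le_of_le_toReal ?_
  rw [integral_eq_lintegral_pos_part_sub_lintegral_neg_part hf]
  exact sub_le_self _ ENNReal.toReal_nonneg

/-! ### Bounds for mean numbers of pairs of points. -/

namespace IsIndependentMarking

variable {Ω : Type*} [MeasurableSpace Ω] {μ : Measure Ω} [IsProbabilityMeasure μ]
  {X : ℕ → Ω → Plane} {M : ℕ → Ω → Bool} {p lam : ℝ}

lemma integrable_pow_markedCount (hM : IsIndependentMarking μ X M p) {C E D : Set Plane}
    (hC : MeasurableSet C) (hE : MeasurableSet E) (hD : MeasurableSet D) {s r t : ℝ}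
    (hs0 : 0 ≤ s) (hs1 : s ≤ 1) (hr0 : 0 ≤ r) (hr1 : r ≤ 1) (ht0 : 0 ≤ t) (ht1 : t ≤ 1) :
    Integrable (fun ω => s ^ markedCount X M true C ω * r ^ markedCount X M true E ω *
        t ^ markedCount X M false D ω) μ := by
  have hm : ∀ (c : ℝ), Measurable fun k : ℕ => c ^ k := fun c => .of_discrete
  refine Integrable.of_bound ((((hm s).comp (hM.measurable_markedCount true hC)).mul
    ((hm r).comp (hM.measurable_markedCount true hE))).mul
    ((hm t).comp (hM.measurable_markedCount false hD))).aestronglyMeasurable 1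
    (ae_of_all _ fun ω => ?_)
  rw [Real.norm_eq_abs, abs_of_nonneg (by positivity)]
  exact mul_le_one₀ (mul_le_one₀ (pow_le_one₀ hs0 hs1) (by positivity) (pow_le_one₀ hr0 hr1))
    (by positivity) (pow_le_one₀ ht0 ht1)

/-- The mean number of pairs of a retained point in `C` and a deleted point in `D`, on the event
that there is no retained point in `E`. -/
lemma lintegral_markedCount_mul_le (hM : IsIndependentMarking μ X M p)
    (hX : IsPoissonProcess μ (pointProcess X) lam) (hlam : 0 ≤ lam) (hp : 0 ≤ p) (hp1 : p ≤ 1)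
    {C E D : Set Plane} (hC : MeasurableSet C) (hE : MeasurableSet E) (hD : MeasurableSet D)
    (hCv : volume C ≠ ⊤) (hEv : volume E ≠ ⊤) (hDv : volume D ≠ ⊤) (hCE : Disjoint C E) :
    ∫⁻ ω, ENNReal.ofReal (markedCount X M true C ω * markedCount X M false D ω *
        0 ^ markedCount X M true E ω) ∂μ ≤
      ENNReal.ofReal (p * lam * volume.real C * ((1 - p) * lam * volume.real D) *
        Real.exp (-(p * lam * volume.real E))) := by
  set a := p * lam * volume.real C
  set d := (1 - p) * lam * volume.real D
  set e := p * lam * volume.real E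
  -- Each quotient tends to its count as `h → 0`, and `0 ^ N` is the indicator of `N = 0` because `0
  -- ^ 0 = 1`.
  set f : ℝ → Ω → ℝ := fun h ω => (1 - (1 - h) ^ markedCount X M true C ω) / h *
    ((1 - (1 - h) ^ markedCount X M false D ω) / h) * 0 ^ markedCount X M true E ω with hf
  have hfm : ∀ h, Measurable (f h) := fun h => by
    have h1 : Measurable fun k : ℕ => (1 - (1 - h) ^ k) / h := .of_discrete
    have h2 : Measurable fun k : ℕ => (0 : ℝ) ^ k := .of_discrete
    exact ((h1.comp (hM.measurable_markedCount true hC)).mul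
      (h1.comp (hM.measurable_markedCount false hD))).mul
        (h2.comp (hM.measurable_markedCount true hE))
  have hint : ∀ h, 0 < h → h < 1 → ∫⁻ ω, ENNReal.ofReal (f h ω) ∂μ =
      ENNReal.ofReal ((1 - Real.exp (-(a * h))) / h * ((1 - Real.exp (-(d * h))) / h) *
        Real.exp (-e)) := fun h h0 h1 => by
    have hG := fun {s t : ℝ} (hs0 : 0 ≤ s) (hs1 : s ≤ 1) (ht0 : 0 ≤ t) (ht1 : t ≤ 1) =>
      hM.integral_pow_markedCount hX hlam hp hp1 hC hE hD hCv hEv hDv hCE hs0 hs1 le_rfl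
        zero_le_one ht0 ht1
    have hI := fun {s t : ℝ} (hs0 : 0 ≤ s) (hs1 : s ≤ 1) (ht0 : 0 ≤ t) (ht1 : t ≤ 1) =>
      hM.integrable_pow_markedCount hC hE hD hs0 hs1 le_rfl zero_le_one ht0 ht1
    have hh0 : 0 ≤ 1 - h := by linarith
    have hh1 : 1 - h ≤ 1 := by linarith
    -- Expanding the product expresses `f h` through four generating functions, all at `r = 0`.
    have hexp : f h = fun ω => (h⁻¹ * h⁻¹) *
        (((1 ^ markedCount X M true C ω * 0 ^ markedCount X M true E ω *
          1 ^ markedCount X M false D ω -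
        (1 - h) ^ markedCount X M true C ω * 0 ^ markedCount X M true E ω *
          1 ^ markedCount X M false D ω) -
        1 ^ markedCount X M true C ω * 0 ^ markedCount X M true E ω *
          (1 - h) ^ markedCount X M false D ω) +
        (1 - h) ^ markedCount X M true C ω * 0 ^ markedCount X M true E ω *
          (1 - h) ^ markedCount X M false D ω) := by
      funext ω
      simp only [hf, one_pow]
      ring
    have i1 := hI zero_le_one le_rfl zero_le_one le_rfl
    have i2 := hI hh0 hh1 zero_le_one le_rfl
    have i3 := hI zero_le_one le_rfl hh0 hh1
    have i4 := hI hh0 hh1 hh0 hh1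
    have i5 : Integrable (fun ω => 1 ^ markedCount X M true C ω *
        0 ^ markedCount X M true E ω * 1 ^ markedCount X M false D ω -
        (1 - h) ^ markedCount X M true C ω * 0 ^ markedCount X M true E ω *
          1 ^ markedCount X M false D ω) μ := i1.sub i2
    have i6 : Integrable (fun ω => 1 ^ markedCount X M true C ω *
        0 ^ markedCount X M true E ω * 1 ^ markedCount X M false D ω -
        (1 - h) ^ markedCount X M true C ω * 0 ^ markedCount X M true E ω *
          1 ^ markedCount X M false D ω -
        1 ^ markedCount X M true C ω * 0 ^ markedCount X M true E ω *
          (1 - h) ^ markedCount X M false D ω) μ := i5.sub i3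
    have hfi : Integrable (f h) μ := by
      rw [hexp]
      exact (i6.add i4).const_mul _
    rw [← ofReal_integral_eq_lintegral_ofReal hfi (ae_of_all _ fun ω => ?_)]
    · congr 1
      rw [hexp, integral_const_mul, integral_add i6 i4,
        integral_sub i5 i3, integral_sub i1 i2, hG zero_le_one le_rfl zero_le_one le_rfl,
        hG hh0 hh1 zero_le_one le_rfl, hG zero_le_one le_rfl hh0 hh1, hG hh0 hh1 hh0 hh1]
      simp only [sub_self, mul_zero, zero_add, add_zero, sub_zero, mul_one, sub_sub_cancel, neg_add,
        Real.exp_add]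
      ring
    · have : ∀ N : ℕ, 0 ≤ (1 - (1 - h) ^ N) / h := fun N =>
        div_nonneg (sub_nonneg.2 (pow_le_one₀ hh0 hh1)) h0.le
      exact mul_nonneg (mul_nonneg (this _) (this _)) (by positivity)
  obtain ⟨u, hu⟩ := exists_seq_tendsto (𝓝[>] (0 : ℝ))
  have hpt : ∀ ω, liminf (fun n => ENNReal.ofReal (f (u n) ω)) atTop =
      ENNReal.ofReal (markedCount X M true C ω * markedCount X M false D ω *
        0 ^ markedCount X M true E ω) := fun ω => by
    refine Tendsto.liminf_eq ?_
    refine ENNReal.tendsto_ofReal (Tendsto.mul_const _ ?_)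
    exact ((tendsto_one_sub_pow_div _).comp hu).mul ((tendsto_one_sub_pow_div _).comp hu)
  simp_rw [← hpt]
  -- Fatou's lemma; only the upper bound is needed.
  refine (lintegral_liminf_le fun n => (hfm (u n)).ennreal_ofReal).trans_eq ?_
  refine Tendsto.liminf_eq ?_
  have hlim : Tendsto (fun h => ENNReal.ofReal ((1 - Real.exp (-(a * h))) / h *
      ((1 - Real.exp (-(d * h))) / h) * Real.exp (-e))) (𝓝[>] 0)
      (𝓝 (ENNReal.ofReal (a * d * Real.exp (-e)))) :=
    ENNReal.tendsto_ofReal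
      (((tendsto_one_sub_exp_div a).mul (tendsto_one_sub_exp_div d)).mul_const _)
  refine (hlim.comp hu).congr' ?_
  filter_upwards [hu (Ioo_mem_nhdsGT (zero_lt_one' ℝ))] with n hn
  exact (hint _ hn.1 hn.2).symm

/-- A lower bound for the mean number of deleted points in `D` on the event that there is exactly
one retained point in `C` and none in `E`. -/
lemma le_lintegral_markedCount (hM : IsIndependentMarking μ X M p)
    (hX : IsPoissonProcess μ (pointProcess X) lam) (hlam : 0 ≤ lam) (hp : 0 ≤ p) (hp1 : p ≤ 1)
    {C E D : Set Plane} (hC : MeasurableSet C) (hE : MeasurableSet E) (hD : MeasurableSet D)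
    (hCv : volume C ≠ ⊤) (hEv : volume E ≠ ⊤) (hDv : volume D ≠ ⊤) (hCE : Disjoint C E) :
    ENNReal.ofReal (p * lam * volume.real C * ((1 - p) * lam * volume.real D) *
        Real.exp (-(p * lam * volume.real C + p * lam * volume.real E))) ≤
      ∫⁻ ω, ENNReal.ofReal ((if markedCount X M true C ω = 1 then 1 else 0) *
        markedCount X M false D ω * 0 ^ markedCount X M true E ω) ∂μ := by
  set a := p * lam * volume.real C
  set d := (1 - p) * lam * volume.real D
  set e := p * lam * volume.real E
  have hint : ∀ h, 0 < h → h < 1 → ENNReal.ofReal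
      ((Real.exp (-a) * ((Real.exp (a * h) - 1) / h) - h) *
        ((1 - Real.exp (-(d * h))) / h) * Real.exp (-e)) ≤
      ∫⁻ ω, ENNReal.ofReal ((if markedCount X M true C ω = 1 then 1 else 0) *
        markedCount X M false D ω * 0 ^ markedCount X M true E ω) ∂μ := fun h h0 h1 => by
    -- A pointwise minorant of the target, possibly negative, whose integral is explicit; the
    -- supremum is approached as `h → 0`.
    set f : Ω → ℝ := fun ω => ((h ^ markedCount X M true C ω - 0 ^ markedCount X M true C ω) / h -
      h) * ((1 - (1 - h) ^ markedCount X M false D ω) / h) * 0 ^ markedCount X M true E ω with hf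
    have hG := fun {s t : ℝ} (hs0 : 0 ≤ s) (hs1 : s ≤ 1) (ht0 : 0 ≤ t) (ht1 : t ≤ 1) =>
      hM.integral_pow_markedCount hX hlam hp hp1 hC hE hD hCv hEv hDv hCE hs0 hs1 le_rfl
        zero_le_one ht0 ht1
    have hI := fun {s t : ℝ} (hs0 : 0 ≤ s) (hs1 : s ≤ 1) (ht0 : 0 ≤ t) (ht1 : t ≤ 1) =>
      hM.integrable_pow_markedCount hC hE hD hs0 hs1 le_rfl zero_le_one ht0 ht1
    have hh0 : 0 ≤ 1 - h := by linarith
    have hh1 : 1 - h ≤ 1 := by linarith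
    set g : ℝ → Ω → ℝ := fun s ω => s ^ markedCount X M true C ω * 0 ^ markedCount X M true E ω *
        1 ^ markedCount X M false D ω - s ^ markedCount X M true C ω *
        0 ^ markedCount X M true E ω * (1 - h) ^ markedCount X M false D ω with hg
    have hgi : ∀ {s}, 0 ≤ s → s ≤ 1 → Integrable (g s) μ := fun hs0 hs1 =>
      (hI hs0 hs1 zero_le_one le_rfl).sub (hI hs0 hs1 hh0 hh1)
    have hgI : ∀ {s}, 0 ≤ s → s ≤ 1 → ∫ ω, g s ω ∂μ =
        Real.exp (-e) * Real.exp (-(a * (1 - s))) * (1 - Real.exp (-(d * h))) := fun {s} hs0 hs1 => by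
      rw [hg, integral_sub (hI hs0 hs1 zero_le_one le_rfl) (hI hs0 hs1 hh0 hh1),
        hG hs0 hs1 zero_le_one le_rfl, hG hs0 hs1 hh0 hh1]
      simp only [sub_self, mul_zero, add_zero, sub_zero, mul_one, sub_sub_cancel, neg_add,
        Real.exp_add]
      ring
    have hexp : f = fun ω => h⁻¹ * (h⁻¹ * (g h ω - g 0 ω) - h * g 1 ω) := by
      funext ω
      simp only [hf, hg, one_pow]
      ring
    have j := hgi h0.le h1.le
    have j0 := hgi le_rfl zero_le_one
    have j1 := hgi zero_le_one le_rfl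
    have j2 : Integrable (fun ω => h⁻¹ * (g h ω - g 0 ω)) μ := (j.sub j0).const_mul _
    have hfi : Integrable f μ := by
      rw [hexp]
      exact (j2.sub (j1.const_mul _)).const_mul _
    have hval : ∫ ω, f ω ∂μ = (Real.exp (-a) * ((Real.exp (a * h) - 1) / h) - h) *
        ((1 - Real.exp (-(d * h))) / h) * Real.exp (-e) := by
      rw [hexp, integral_const_mul, integral_sub j2 (j1.const_mul _),
        integral_const_mul, integral_const_mul, integral_sub j j0, hgI h0.le h1.le,
        hgI le_rfl zero_le_one, hgI zero_le_one le_rfl,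
        show -(a * (1 - h)) = -a + a * h by ring, Real.exp_add]
      simp only [sub_zero, mul_one, sub_self, mul_zero, neg_zero, Real.exp_zero]
      field_simp
    rw [← hval]
    refine (ofReal_integral_le_lintegral_ofReal hfi).trans (lintegral_mono fun ω => ?_)
    refine ENNReal.ofReal_le_ofReal (mul_le_mul_of_nonneg_right ?_ (by positivity))
    have h3 : (1 - (1 - h) ^ markedCount X M false D ω) / h ≤ markedCount X M false D ω := by
      simpa using one_sub_pow_div_le hh0 (by linarith : 1 - h < 1) (markedCount X M false D ω)
    have h4 : 0 ≤ (1 - (1 - h) ^ markedCount X M false D ω) / h :=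
      div_nonneg (sub_nonneg.2 (pow_le_one₀ hh0 hh1)) h0.le
    exact (mul_le_mul_of_nonneg_right (pow_sub_zero_pow_div_le h0 h1.le _) h4).trans
      (mul_le_mul_of_nonneg_left h3 (by split_ifs <;> simp))
  have hexp : Tendsto (fun h => (Real.exp (a * h) - 1) / h) (𝓝[>] 0) (𝓝 a) := by
    have := (tendsto_one_sub_exp_div (-a)).neg
    rw [neg_neg] at this
    refine this.congr fun h => ?_
    rw [neg_mul, neg_neg]; ring
  have hlim : Tendsto (fun h => ENNReal.ofReal
      ((Real.exp (-a) * ((Real.exp (a * h) - 1) / h) - h) *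
        ((1 - Real.exp (-(d * h))) / h) * Real.exp (-e))) (𝓝[>] 0)
      (𝓝 (ENNReal.ofReal ((Real.exp (-a) * a - 0) * d * Real.exp (-e)))) :=
    ENNReal.tendsto_ofReal ((((hexp.const_mul _).sub
      (tendsto_id.mono_left nhdsWithin_le_nhds)).mul (tendsto_one_sub_exp_div d)).mul_const _)
  have hval : a * d * Real.exp (-(a + e)) = (Real.exp (-a) * a - 0) * d * Real.exp (-e) := by
    rw [neg_add, Real.exp_add]; ring
  rw [hval]
  refine le_of_tendsto hlim ?_
  filter_upwards [Ioo_mem_nhdsGT (zero_lt_one' ℝ)] with h hh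
  exact hint h hh.1 hh.2

end IsIndependentMarking

/-! ### Comparison of measures on small rectangles. -/

section Grid

variable {α : Type*} [PseudoMetricSpace α] [TopologicalSpace.SeparableSpace α] [Nonempty α]
  [MeasurableSpace α] [OpensMeasurableSpace α]

lemma exists_measurable_partition_closedBall (α : Type*) [PseudoMetricSpace α]
    [TopologicalSpace.SeparableSpace α] [Nonempty α] [MeasurableSpace α] [OpensMeasurableSpace α]
    {δ : ℝ} (hδ : 0 < δ) : ∃ (A : ℕ → Set α) (c : ℕ → α), (∀ i, MeasurableSet (A i)) ∧
      Pairwise (Function.onFun Disjoint A) ∧ (⋃ i, A i) = Set.univ ∧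
      ∀ i, A i ⊆ Metric.closedBall (c i) δ := by
  refine ⟨disjointed fun i => Metric.closedBall (TopologicalSpace.denseSeq α i) δ,
    TopologicalSpace.denseSeq α, fun i => MeasurableSet.disjointed
      (fun _ => Metric.isClosed_closedBall.measurableSet) i, disjoint_disjointed _, ?_,
    fun i => disjointed_subset _ i⟩
  rw [iUnion_disjointed, Set.eq_univ_iff_forall]
  intro x
  obtain ⟨_, hi, ⟨i, rfl⟩⟩ := Metric.dense_iff.1 (TopologicalSpace.denseRange_denseSeq α) x δ hδ
  exact Set.mem_iUnion.2 ⟨i, Metric.mem_closedBall'.2 (Metric.mem_ball.1 hi).le⟩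

/-- Two measures on a product can be compared on rectangles by comparing them on small ones. -/
lemma measure_prod_le_of_small {ρ ν : Measure (α × α)} {δ : ℝ} (hδ : 0 < δ)
    (h : ∀ (c d : α) (C D : Set α), MeasurableSet C → MeasurableSet D →
      C ⊆ Metric.closedBall c δ → D ⊆ Metric.closedBall d δ → ρ (C ×ˢ D) ≤ ν (C ×ˢ D))
    {C D : Set α} (hC : MeasurableSet C) (hD : MeasurableSet D) : ρ (C ×ˢ D) ≤ ν (C ×ˢ D) := by
  obtain ⟨A, c, hA, hAd, hAu, hAc⟩ := exists_measurable_partition_closedBall α hδ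
  have hU : C ×ˢ D = ⋃ q : ℕ × ℕ, (C ∩ A q.1) ×ˢ (D ∩ A q.2) := by
    ext ⟨x, y⟩
    obtain ⟨i, hi⟩ := Set.mem_iUnion.1 (hAu ▸ Set.mem_univ x : x ∈ ⋃ i, A i)
    obtain ⟨j, hj⟩ := Set.mem_iUnion.1 (hAu ▸ Set.mem_univ y : y ∈ ⋃ i, A i)
    simp only [Set.mem_iUnion, Set.mem_prod, Set.mem_inter_iff]
    exact ⟨fun hxy => ⟨(i, j), ⟨hxy.1, hi⟩, hxy.2, hj⟩, fun ⟨_, hq⟩ => ⟨hq.1.1, hq.2.1⟩⟩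
  have hdisj : Pairwise (Function.onFun Disjoint
      fun q : ℕ × ℕ => (C ∩ A q.1) ×ˢ (D ∩ A q.2)) := by
    rintro ⟨i, j⟩ ⟨i', j'⟩ hne
    rw [Function.onFun, Set.disjoint_left]
    rintro ⟨x, y⟩ ⟨hx, hy⟩ ⟨hx', hy'⟩
    refine hne (Prod.ext ?_ ?_)
    · by_contra hij
      exact Set.disjoint_left.1 (hAd hij) hx.2 hx'.2
    · by_contra hij
      exact Set.disjoint_left.1 (hAd hij) hy.2 hy'.2
  have hm : ∀ q : ℕ × ℕ, MeasurableSet ((C ∩ A q.1) ×ˢ (D ∩ A q.2)) := fun q =>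
    (hC.inter (hA _)).prod (hD.inter (hA _))
  rw [hU, measure_iUnion hdisj hm, measure_iUnion hdisj hm]
  exact ENNReal.tsum_le_tsum fun q => h (c q.1) (c q.2) _ _ (hC.inter (hA _)) (hD.inter (hA _))
    (Set.inter_subset_right.trans (hAc _)) (Set.inter_subset_right.trans (hAc _))

end Grid

/-! ### Served pairs and their intensity on small rectangles. -/

/-- The point `m` is deleted, and the point `n` is, among the retained points, a nearest one. -/
def IsServedBy {Ω : Type*} (X : ℕ → Ω → Plane) (M : ℕ → Ω → Bool) (n m : ℕ) (ω : Ω) : Prop :=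
  M n ω = true ∧ M m ω = false ∧
    ∀ k, M k ω = true → dist (X m ω) (X n ω) ≤ dist (X m ω) (X k ω)

/-- The intensity measure of the pairs of a retained point and a deleted point that it serves. -/
noncomputable def servedPairMeasure {Ω : Type*} [MeasurableSpace Ω] (μ : Measure Ω)
    (X : ℕ → Ω → Plane) (M : ℕ → Ω → Bool) : Measure (Plane × Plane) :=
  Measure.sum fun q : ℕ × ℕ =>
    (μ.restrict {ω | IsServedBy X M q.1 q.2 ω}).map fun ω => (X q.1 ω, X q.2 ω)

/-- The density of a pair of a retained and a deleted point at distance `r`, for retained and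
deleted points of densities `a` and `b`, such that the former serves the latter. -/
noncomputable def servedPairDensity (a b r : ℝ) : ENNReal :=
  -- Truncation at `0` matches the area of a ball whose radius, such as `dist c d - 3 * δ`, may be
  -- negative.
  ENNReal.ofReal (a * b * Real.exp (-(a * Real.pi * max r 0 ^ 2)))

lemma servedPairDensity_antitone {a b : ℝ} (ha : 0 ≤ a) (hb : 0 ≤ b) :
    Antitone (servedPairDensity a b) := fun r s hrs => by
  unfold servedPairDensity
  have := Real.pi_pos
  gcongr

lemma continuous_servedPairDensity (a b : ℝ) : Continuous (servedPairDensity a b) := by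
  unfold servedPairDensity
  exact ENNReal.continuous_ofReal.comp (by fun_prop)

lemma servedPairDensity_le {a b : ℝ} (ha : 0 ≤ a) (hb : 0 ≤ b) (r : ℝ) :
    servedPairDensity a b r ≤ ENNReal.ofReal (a * b) := by
  refine ENNReal.ofReal_le_ofReal (mul_le_of_le_one_right (by positivity) ?_)
  rw [Real.exp_le_one_iff, neg_nonpos]
  have := Real.pi_pos
  positivity

lemma volume_real_ball (x : Plane) (r : ℝ) :
    volume.real (Metric.ball x r) = Real.pi * max r 0 ^ 2 := by
  rw [measureReal_def, EuclideanSpace.volume_ball_fin_two, ENNReal.toReal_mul,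
    ENNReal.toReal_pow, ENNReal.toReal_ofReal', mul_comm]
  simp [Real.pi_pos.le]

namespace IsIndependentMarking

variable {Ω : Type*} [MeasurableSpace Ω] {μ : Measure Ω}
  {X : ℕ → Ω → Plane} {M : ℕ → Ω → Bool} {p lam : ℝ}

lemma measurableSet_isServedBy (hM : IsIndependentMarking μ X M p) (n m : ℕ) :
    MeasurableSet {ω | IsServedBy X M n m ω} := by
  have hmk : ∀ n b, MeasurableSet {ω | M n ω = b} := fun n b =>
    hM.measurable_marks n (measurableSet_singleton b)
  refine (hmk n true).inter ((hmk m false).inter ?_)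
  have hk : ∀ k, MeasurableSet
      {ω | M k ω = true → dist (X m ω) (X n ω) ≤ dist (X m ω) (X k ω)} := fun k => ?_
  · have e : {ω | ∀ k, M k ω = true → dist (X m ω) (X n ω) ≤ dist (X m ω) (X k ω)} =
        ⋂ k, {ω | M k ω = true → dist (X m ω) (X n ω) ≤ dist (X m ω) (X k ω)} := by
      ext ω; simp
    have h := MeasurableSet.iInter hk
    rw [← e] at h
    exact h
  have : {ω | M k ω = true → dist (X m ω) (X n ω) ≤ dist (X m ω) (X k ω)} =
      {ω | M k ω = true}ᶜ ∪ {ω | dist (X m ω) (X n ω) ≤ dist (X m ω) (X k ω)} := by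
    ext ω; exact imp_iff_not_or
  rw [this]
  exact (hmk k true).compl.union (measurableSet_le
    ((hM.measurable_points m).dist (hM.measurable_points n))
    ((hM.measurable_points m).dist (hM.measurable_points k)))

lemma servedPairMeasure_prod (hM : IsIndependentMarking μ X M p) {C D : Set Plane}
    (hC : MeasurableSet C) (hD : MeasurableSet D) :
    servedPairMeasure μ X M (C ×ˢ D) =
      ∫⁻ ω, ({q : ℕ × ℕ | IsServedBy X M q.1 q.2 ω ∧ X q.1 ω ∈ C ∧ X q.2 ω ∈ D}.encard : ENNReal)
        ∂μ := by
  have hm : ∀ q : ℕ × ℕ, MeasurableSet {ω | IsServedBy X M q.1 q.2 ω ∧ X q.1 ω ∈ C ∧ X q.2 ω ∈ D} :=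
    fun q => (hM.measurableSet_isServedBy _ _).inter
      ((hM.measurable_points _ hC).inter (hM.measurable_points _ hD))
  rw [servedPairMeasure, Measure.sum_apply _ (hC.prod hD)]
  have h1 : ∀ ω, ({q : ℕ × ℕ | IsServedBy X M q.1 q.2 ω ∧ X q.1 ω ∈ C ∧ X q.2 ω ∈ D}.encard :
      ENNReal) = ∑' q : ℕ × ℕ, {ω | IsServedBy X M q.1 q.2 ω ∧ X q.1 ω ∈ C ∧ X q.2 ω ∈ D}.indicator
        (1 : Ω → ENNReal) ω := fun ω => by
    rw [← ENNReal.tsum_set_one, _root_.tsum_subtype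
      {q : ℕ × ℕ | IsServedBy X M q.1 q.2 ω ∧ X q.1 ω ∈ C ∧ X q.2 ω ∈ D} (fun _ => (1 : ENNReal))]
    rfl
  simp_rw [h1]
  rw [lintegral_tsum fun q => (measurable_one.indicator (hm q)).aemeasurable]
  refine tsum_congr fun q => ?_
  have hX : Measurable fun ω => (X q.1 ω, X q.2 ω) :=
    (hM.measurable_points _).prodMk (hM.measurable_points _)
  rw [lintegral_indicator_one (hm q), Measure.map_apply hX (hC.prod hD),
    Measure.restrict_apply (hX (hC.prod hD))]
  congr 1
  ext ω
  exact and_comm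

lemma ae_finite (hX : IsPoissonProcess μ (pointProcess X) lam) {B : Set Plane}
    (hB : MeasurableSet B) (hv : volume B ≠ ⊤) : ∀ᵐ ω ∂μ, {n | X n ω ∈ B}.Finite := by
  filter_upwards [hX.ae_ne_top hB hv] with ω hω
  exact finite_of_pointProcess_ne_top X ω hB hω

variable [IsProbabilityMeasure μ]

/-- A retained point in `E` would beat every retained point of `C` for every device in `D`: it is
closer than `dist c d - 2 * δ` to the device, while points of `C` are at least that far. So served
pairs exist only if `E` is empty of retained points. -/
lemma servedPairMeasure_prod_le_of_small (hM : IsIndependentMarking μ X M p)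
    (hX : IsPoissonProcess μ (pointProcess X) lam) (hlam : 0 ≤ lam) (hp : 0 ≤ p) (hp1 : p ≤ 1)
    {δ : ℝ} {c d : Plane} {C D : Set Plane} (hC : MeasurableSet C) (hD : MeasurableSet D)
    (hCc : C ⊆ Metric.closedBall c δ) (hDd : D ⊆ Metric.closedBall d δ) :
    servedPairMeasure μ X M (C ×ˢ D) ≤
      servedPairDensity (p * lam) ((1 - p) * lam) (dist c d - 3 * δ) *
        (volume C * volume D) := by
  have hCv : volume C ≠ ⊤ := measure_ne_top_of_subset hCc measure_closedBall_lt_top.ne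
  have hDv : volume D ≠ ⊤ := measure_ne_top_of_subset hDd measure_closedBall_lt_top.ne
  set E := Metric.ball d (dist c d - 3 * δ) with hE
  have hEm : MeasurableSet E := Metric.isOpen_ball.measurableSet
  have hEv : volume E ≠ ⊤ := measure_ball_lt_top.ne
  have hCE : Disjoint C E := by
    rw [Set.disjoint_left]
    intro z hz hzE
    have h1 : dist z c ≤ δ := hCc hz
    have h2 : dist z d < dist c d - 3 * δ := hzE
    have h3 := dist_triangle_left c d z
    have h4 := dist_nonneg (x := z) (y := c)
    linarith
  have hbound := hM.lintegral_markedCount_mul_le hX hlam hp hp1 hC hEm hD hCv hEv hDv hCE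
  have hval : ENNReal.ofReal (p * lam * volume.real C * ((1 - p) * lam * volume.real D) *
        Real.exp (-(p * lam * volume.real E))) =
      servedPairDensity (p * lam) ((1 - p) * lam) (dist c d - 3 * δ) *
        (volume C * volume D) := by
    rw [← ofReal_measureReal hCv, ← ofReal_measureReal hDv, servedPairDensity, hE,
      volume_real_ball, ← ENNReal.ofReal_mul (by positivity), ← ENNReal.ofReal_mul]
    · congr 1
      rw [← mul_assoc (p * lam)]; ring
    · have := sub_nonneg.2 hp1
      positivity
  rw [← hval, hM.servedPairMeasure_prod hC hD]
  refine le_trans (lintegral_mono_ae ?_) hbound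
  filter_upwards [ae_finite hX hC hCv, ae_finite hX hD hDv, ae_finite hX hEm hEv]
    with ω fC fD fE
  have gC : {n | M n ω = true ∧ X n ω ∈ C}.Finite := fC.subset fun n hn => hn.2
  have gD : {n | M n ω = false ∧ X n ω ∈ D}.Finite := fD.subset fun n hn => hn.2
  have gE : {n | M n ω = true ∧ X n ω ∈ E}.Finite := fE.subset fun n hn => hn.2
  by_cases hne : markedCount X M true E ω = 0
  · have hsub : {q : ℕ × ℕ | IsServedBy X M q.1 q.2 ω ∧ X q.1 ω ∈ C ∧ X q.2 ω ∈ D} ⊆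
        {n | M n ω = true ∧ X n ω ∈ C} ×ˢ {n | M n ω = false ∧ X n ω ∈ D} :=
      fun q hq => ⟨⟨hq.1.1, hq.2.1⟩, hq.1.2.1, hq.2.2⟩
    have h1 := Set.encard_le_encard hsub
    rw [hne, pow_zero, mul_one, markedCount, markedCount, ← Nat.cast_mul, ENNReal.ofReal_natCast]
    rw [Set.encard_prod, ← gC.cast_ncard_eq, ← gD.cast_ncard_eq] at h1
    exact_mod_cast h1
  · have hemp : {q : ℕ × ℕ | IsServedBy X M q.1 q.2 ω ∧ X q.1 ω ∈ C ∧ X q.2 ω ∈ D} = ∅ := by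
      rw [markedCount, Set.ncard_eq_zero gE, ← ne_eq, ← Set.nonempty_iff_ne_empty] at hne
      obtain ⟨k, hk, hkE⟩ := hne
      rw [Set.eq_empty_iff_forall_notMem]
      rintro ⟨n, m⟩ ⟨hs, hnC, hmD⟩
      have h0 := hs.2.2 k hk
      have h1 : dist (X n ω) c ≤ δ := hCc hnC
      have h2 : dist (X m ω) d ≤ δ := hDd hmD
      have h3 : dist (X k ω) d < dist c d - 3 * δ := hkE
      have h4 := dist_triangle4_left (X n ω) (X m ω) c d
      have h5 := dist_triangle_right (X m ω) (X k ω) d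
      rw [dist_comm (X n ω) (X m ω)] at h4
      simp only at h0
      linarith
    rw [hemp]
    simp

/-- A single retained point in `C`, with none in `F \ C`, serves all devices of `D`: it is within
`dist c d + 2 * δ` of each, and points outside `F` are no closer than that. The void probability of
`F \ C` and the factor `exp` from `C` combine to that of the disc `F`. -/
lemma le_servedPairMeasure_prod_of_small (hM : IsIndependentMarking μ X M p)
    (hX : IsPoissonProcess μ (pointProcess X) lam) (hlam : 0 ≤ lam) (hp : 0 ≤ p) (hp1 : p ≤ 1)
    {δ : ℝ} (hδ : 0 < δ) {c d : Plane} {C D : Set Plane} (hC : MeasurableSet C)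
    (hD : MeasurableSet D)
    (hCc : C ⊆ Metric.closedBall c δ) (hDd : D ⊆ Metric.closedBall d δ) :
    servedPairDensity (p * lam) ((1 - p) * lam) (dist c d + 3 * δ) * (volume C * volume D) ≤
      servedPairMeasure μ X M (C ×ˢ D) := by
  have hCv : volume C ≠ ⊤ := measure_ne_top_of_subset hCc measure_closedBall_lt_top.ne
  have hDv : volume D ≠ ⊤ := measure_ne_top_of_subset hDd measure_closedBall_lt_top.ne
  set F := Metric.ball d (dist c d + 3 * δ) with hF
  have hFv : volume F ≠ ⊤ := measure_ball_lt_top.ne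
  have hEm : MeasurableSet (F \ C) := Metric.isOpen_ball.measurableSet.diff hC
  have hEv : volume (F \ C) ≠ ⊤ := measure_ne_top_of_subset Set.sdiff_subset hFv
  have hCF : C ⊆ F := fun z hz => by
    have h1 : dist z c ≤ δ := hCc hz
    have h3 := dist_triangle z c d
    exact Metric.mem_ball.2 (by linarith)
  have hvol : volume.real C + volume.real (F \ C) = Real.pi * max (dist c d + 3 * δ) 0 ^ 2 := by
    rw [← volume_real_ball d, measureReal_sdiff hCF hC hFv]
    ring
  have hbound := hM.le_lintegral_markedCount hX hlam hp hp1 hC hEm hD hCv hEv hDv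
    Set.disjoint_sdiff_right
  have hval : ENNReal.ofReal (p * lam * volume.real C * ((1 - p) * lam * volume.real D) *
        Real.exp (-(p * lam * volume.real C + p * lam * volume.real (F \ C)))) =
      servedPairDensity (p * lam) ((1 - p) * lam) (dist c d + 3 * δ) *
        (volume C * volume D) := by
    rw [← ofReal_measureReal hCv, ← ofReal_measureReal hDv, servedPairDensity, ← mul_add, hvol,
      ← ENNReal.ofReal_mul (by positivity), ← ENNReal.ofReal_mul]
    · congr 1
      rw [← mul_assoc (p * lam)]; ring
    · have := sub_nonneg.2 hp1
      positivity
  rw [← hval, hM.servedPairMeasure_prod hC hD]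
  refine hbound.trans (lintegral_mono_ae ?_)
  filter_upwards [ae_finite hX hD hDv, ae_finite hX hEm hEv] with ω fD fE
  have gD : {n | M n ω = false ∧ X n ω ∈ D}.Finite := fD.subset fun n hn => hn.2
  have gE : {n | M n ω = true ∧ X n ω ∈ F \ C}.Finite := fE.subset fun n hn => hn.2
  by_cases hne : markedCount X M true (F \ C) ω = 0
  · by_cases hone : markedCount X M true C ω = 1
    · rw [if_pos hone, hne, pow_zero, mul_one, one_mul, ENNReal.ofReal_natCast]
      rw [markedCount, Set.ncard_eq_zero gE, Set.eq_empty_iff_forall_notMem] at hne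
      rw [markedCount, Set.ncard_eq_one] at hone
      obtain ⟨n, hn⟩ := hone
      have hnC : M n ω = true ∧ X n ω ∈ C := by
        change n ∈ {n | M n ω = true ∧ X n ω ∈ C}
        rw [hn]; rfl
      have hsub : ({n} : Set ℕ) ×ˢ {m | M m ω = false ∧ X m ω ∈ D} ⊆
          {q : ℕ × ℕ | IsServedBy X M q.1 q.2 ω ∧ X q.1 ω ∈ C ∧ X q.2 ω ∈ D} := by
        rintro ⟨n', m⟩ ⟨hn', hm, hmD⟩
        obtain rfl : n' = n := hn'
        refine ⟨⟨hnC.1, hm, fun k hk => ?_⟩, hnC.2, hmD⟩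
        by_cases hkn : k = n'
        · rw [hkn]
        have hkC : X k ω ∉ C := fun h => hkn (by
          have : k ∈ {n | M n ω = true ∧ X n ω ∈ C} := ⟨hk, h⟩
          rwa [hn] at this)
        have hkF : X k ω ∉ F := fun h => hne k ⟨hk, h, hkC⟩
        rw [hF, Metric.mem_ball, not_lt] at hkF
        have h1 : dist (X n' ω) c ≤ δ := hCc hnC.2
        have h2 : dist (X m ω) d ≤ δ := hDd hmD
        have h4 := dist_triangle4_right (X m ω) (X n' ω) d c
        have h5 := dist_triangle_left (X k ω) d (X m ω)
        rw [dist_comm d c] at h4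
        simp only
        linarith
      have h1 := Set.encard_le_encard hsub
      rw [Set.encard_prod, Set.encard_singleton, one_mul, ← gD.cast_ncard_eq] at h1
      exact_mod_cast h1
    · rw [if_neg hone]; simp
  · rw [zero_pow hne]; simp

end IsIndependentMarking

/-! ### The density of the served pairs. -/

namespace IsIndependentMarking

variable {Ω : Type*} [MeasurableSpace Ω] {μ : Measure Ω} [IsProbabilityMeasure μ]
  {X : ℕ → Ω → Plane} {M : ℕ → Ω → Bool} {p lam : ℝ}

/-- The `5 * δ` is `3 * δ` from the small rectangles plus `2 * δ` for replacing the two centres by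
points within `δ` of them. -/
lemma servedPairMeasure_prod_le (hM : IsIndependentMarking μ X M p)
    (hX : IsPoissonProcess μ (pointProcess X) lam) (hlam : 0 ≤ lam) (hp : 0 ≤ p) (hp1 : p ≤ 1)
    {δ : ℝ} (hδ : 0 < δ) {C D : Set Plane} (hC : MeasurableSet C) (hD : MeasurableSet D) :
    servedPairMeasure μ X M (C ×ˢ D) ≤ ∫⁻ q in C ×ˢ D,
      servedPairDensity (p * lam) ((1 - p) * lam) (dist q.1 q.2 - 5 * δ)
        ∂((volume : Measure Plane).prod volume) := by
  rw [← withDensity_apply _ (hC.prod hD)]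
  refine measure_prod_le_of_small hδ (fun c d C D hC hD hCc hDd => ?_) hC hD
  refine (hM.servedPairMeasure_prod_le_of_small hX hlam hp hp1 hC hD hCc hDd).trans ?_
  rw [withDensity_apply _ (hC.prod hD), ← Measure.prod_prod, ← setLIntegral_const]
  refine setLIntegral_mono' (hC.prod hD) fun q hq => ?_
  refine servedPairDensity_antitone (by positivity)
    (mul_nonneg (sub_nonneg.2 hp1) hlam) ?_
  have h1 : dist q.1 c ≤ δ := hCc hq.1
  have h2 : dist q.2 d ≤ δ := hDd hq.2
  have h3 := dist_triangle4_right q.1 q.2 c d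
  linarith

lemma le_servedPairMeasure_prod (hM : IsIndependentMarking μ X M p)
    (hX : IsPoissonProcess μ (pointProcess X) lam) (hlam : 0 ≤ lam) (hp : 0 ≤ p) (hp1 : p ≤ 1)
    {δ : ℝ} (hδ : 0 < δ) {C D : Set Plane} (hC : MeasurableSet C) (hD : MeasurableSet D) :
    ∫⁻ q in C ×ˢ D, servedPairDensity (p * lam) ((1 - p) * lam) (dist q.1 q.2 + 5 * δ)
        ∂((volume : Measure Plane).prod volume) ≤ servedPairMeasure μ X M (C ×ˢ D) := by
  rw [← withDensity_apply _ (hC.prod hD)]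
  refine measure_prod_le_of_small hδ (fun c d C D hC hD hCc hDd => ?_) hC hD
  refine le_trans ?_ (hM.le_servedPairMeasure_prod_of_small hX hlam hp hp1 hδ hC hD hCc hDd)
  rw [withDensity_apply _ (hC.prod hD), ← Measure.prod_prod, ← setLIntegral_const]
  refine setLIntegral_mono' (hC.prod hD) fun q hq => ?_
  refine servedPairDensity_antitone (by positivity)
    (mul_nonneg (sub_nonneg.2 hp1) hlam) ?_
  have h1 : dist q.1 c ≤ δ := hCc hq.1
  have h2 : dist q.2 d ≤ δ := hDd hq.2
  have h3 := dist_triangle4_left q.1 q.2 c d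
  linarith

/-- Both bounds have the same limit as `δ → 0`: the density is continuous and bounded, and the
rectangle has finite measure. -/
lemma servedPairMeasure_prod_eq (hM : IsIndependentMarking μ X M p)
    (hX : IsPoissonProcess μ (pointProcess X) lam) (hlam : 0 ≤ lam) (hp : 0 ≤ p) (hp1 : p ≤ 1)
    {C D : Set Plane} (hC : MeasurableSet C) (hD : MeasurableSet D) (hCv : volume C ≠ ⊤)
    (hDv : volume D ≠ ⊤) :
    servedPairMeasure μ X M (C ×ˢ D) = ∫⁻ q in C ×ˢ D,
      servedPairDensity (p * lam) ((1 - p) * lam) (dist q.1 q.2)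
        ∂((volume : Measure Plane).prod volume) := by
  have hp1' := sub_nonneg.2 hp1
  have hlim : ∀ s : ℝ, Tendsto (fun n : ℕ => ∫⁻ q in C ×ˢ D,
      servedPairDensity (p * lam) ((1 - p) * lam) (dist q.1 q.2 + s * (1 / ((n : ℝ) + 1)))
        ∂((volume : Measure Plane).prod volume)) atTop (𝓝 (∫⁻ q in C ×ˢ D,
      servedPairDensity (p * lam) ((1 - p) * lam) (dist q.1 q.2)
        ∂((volume : Measure Plane).prod volume))) := fun s => by
    refine tendsto_lintegral_of_dominated_convergence
      (fun _ => ENNReal.ofReal (p * lam * ((1 - p) * lam))) (fun n => ?_)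
      (fun n => ae_of_all _ fun q => servedPairDensity_le (by positivity) (by positivity) _) ?_
      (ae_of_all _ fun q => ?_)
    · exact ((continuous_servedPairDensity _ _).comp (by fun_prop)).measurable
    · rw [setLIntegral_const, Measure.prod_prod]
      exact ENNReal.mul_ne_top ENNReal.ofReal_ne_top (ENNReal.mul_ne_top hCv hDv)
    · refine ((continuous_servedPairDensity _ _).tendsto _).comp ?_
      have := (tendsto_one_div_add_atTop_nhds_zero_nat (𝕜 := ℝ)).const_mul s
      simpa using this.const_add (dist q.1 q.2)
  refine le_antisymm (ge_of_tendsto' (hlim (-5)) fun n => ?_) (le_of_tendsto' (hlim 5) fun n => ?_)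
  · simp only [neg_mul, ← sub_eq_add_neg]
    exact hM.servedPairMeasure_prod_le hX hlam hp hp1 Nat.one_div_pos_of_nat hC hD
  · exact hM.le_servedPairMeasure_prod hX hlam hp hp1 Nat.one_div_pos_of_nat hC hD

/-- The law of the pairs of a retained point and a deleted point that it serves. -/
theorem servedPairMeasure_eq_withDensity (hM : IsIndependentMarking μ X M p)
    (hX : IsPoissonProcess μ (pointProcess X) lam) (hlam : 0 ≤ lam) (hp : 0 ≤ p) (hp1 : p ≤ 1) :
    servedPairMeasure μ X M = ((volume : Measure Plane).prod volume).withDensity fun q =>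
      servedPairDensity (p * lam) ((1 - p) * lam) (dist q.1 q.2) := by
  have hp1' := sub_nonneg.2 hp1
  -- Rectangles determine finite measures, so the measures are first restricted to squares of balls
  -- exhausting the product.
  set U : ℕ → Set Plane := fun n => Metric.ball 0 n with hU
  have hUm : ∀ n, MeasurableSet (U n) := fun n => Metric.isOpen_ball.measurableSet
  have hUU : ⋃ n, U n ×ˢ U n = Set.univ := by
    rw [Set.eq_univ_iff_forall]
    rintro ⟨x, y⟩
    obtain ⟨n, hn⟩ := exists_nat_gt (max (dist x 0) (dist y 0))
    exact Set.mem_iUnion.2 ⟨n, (le_max_left _ _).trans_lt hn, (le_max_right _ _).trans_lt hn⟩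
  refine (Measure.ext_iff_of_iUnion_eq_univ hUU).2 fun n => ?_
  have hfin : IsFiniteMeasure ((servedPairMeasure μ X M).restrict (U n ×ˢ U n)) := by
    refine ⟨?_⟩
    rw [Measure.restrict_apply_univ, hM.servedPairMeasure_prod_eq hX hlam hp hp1 (hUm n) (hUm n)
      measure_ball_lt_top.ne measure_ball_lt_top.ne]
    refine (lintegral_mono fun q => servedPairDensity_le (by positivity) (by positivity) _).trans_lt
      (?_ : _ < _)
    rw [setLIntegral_const, Measure.prod_prod]
    exact ENNReal.mul_lt_top ENNReal.ofReal_lt_top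
      (ENNReal.mul_lt_top measure_ball_lt_top measure_ball_lt_top)
  refine Measure.ext_prod fun {C D} hC hD => ?_
  rw [Measure.restrict_apply (hC.prod hD), Measure.restrict_apply (hC.prod hD), Set.prod_inter_prod,
    hM.servedPairMeasure_prod_eq hX hlam hp hp1 (hC.inter (hUm n)) (hD.inter (hUm n))
      (measure_ne_top_of_subset Set.inter_subset_right measure_ball_lt_top.ne)
      (measure_ne_top_of_subset Set.inter_subset_right measure_ball_lt_top.ne),
    withDensity_apply _ ((hC.inter (hUm n)).prod (hD.inter (hUm n)))]

end IsIndependentMarking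

/-! ### The Palm sum as an integral over served pairs. -/

lemma markedPart_singleton_ne_zero {Ω : Type*} (X : ℕ → Ω → Plane) (M : ℕ → Ω → Bool) (b : Bool)
    (ω : Ω) (y : Plane) : markedPart X M b ω {y} ≠ 0 ↔ ∃ k, M k ω = b ∧ X k ω = y := by
  rw [markedPart_eq_encard X M b ω (measurableSet_singleton y), ne_eq, ← ENat.toENNReal_zero,
    ENat.toENNReal_inj, Set.encard_eq_zero, ← ne_eq, ← Set.nonempty_iff_ne_empty]
  rfl

lemma lintegral_markedPart_eq_tsum {Ω : Type*} (X : ℕ → Ω → Plane) (M : ℕ → Ω → Bool) (b : Bool)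
    (ω : Ω) (f : Plane → ENNReal) :
    ∫⁻ x, f x ∂(markedPart X M b ω) = ∑' n, if M n ω = b then f (X n ω) else 0 := by
  rw [markedPart, lintegral_sum_measure]
  refine tsum_congr fun n => ?_
  split_ifs <;> simp

lemma measurableSet_voronoiCell (φ : Measure Plane) (z : Plane) :
    MeasurableSet (voronoiCell φ z) := by
  refine IsClosed.measurableSet ?_
  have e : voronoiCell φ z = ⋂ (y) (_ : φ {y} ≠ 0), {x | dist x z ≤ dist x y} := by
    ext x; simp [voronoiCell]
  rw [e]
  exact isClosed_biInter fun y _ => isClosed_le (by fun_prop) (by fun_prop)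

lemma sub_mem_voronoiCell_seenFrom {Ω : Type*} (X : ℕ → Ω → Plane) (M : ℕ → Ω → Bool) (ω : Ω)
    (x z : Plane) : x - z ∈ voronoiCell (seenFrom z (markedPart X M true ω)) 0 ↔
      ∀ k, M k ω = true → dist x z ≤ dist x (X k ω) := by
  have h1 : ∀ y, seenFrom z (markedPart X M true ω) {y} = markedPart X M true ω {y + z} := fun y => by
    rw [seenFrom, Measure.map_apply (by fun_prop) (measurableSet_singleton y)]
    congr 1
    ext w
    simp [sub_eq_iff_eq_add]
  have h2 : ∀ y, dist (x - z) y = dist x (y + z) := fun y => by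
    rw [dist_eq_norm, dist_eq_norm, sub_sub, add_comm z]
  simp only [voronoiCell, Set.mem_ofPred_eq, h1, markedPart_singleton_ne_zero, h2, zero_add]
  constructor
  · intro h k hk
    simpa using h (X k ω - z) ⟨k, hk, by simp⟩
  · rintro h y ⟨k, hk, hky⟩
    rw [← hky]
    exact h k hk

/-- The power consumption in the cells of the aggregators in `B`, as a sum over served pairs. -/
lemma setLIntegral_cellPower_eq_tsum {Ω : Type*} (X : ℕ → Ω → Plane) (M : ℕ → Ω → Bool)
    (η α Pmax Pbar : ℝ) {B : Set Plane} (hB : MeasurableSet B) (ω : Ω) :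
    ∫⁻ z in B, cellPower η α Pmax Pbar (seenFrom z (markedPart X M true ω))
        (seenFrom z (markedPart X M false ω)) ∂(markedPart X M true ω) =
      ∑' q : ℕ × ℕ, {ω | IsServedBy X M q.1 q.2 ω}.indicator (fun ω =>
        B.indicator (fun z => ENNReal.ofReal (paPower η α Pmax Pbar (dist (X q.2 ω) z)))
          (X q.1 ω)) ω := by
  classical
  have hcell : ∀ z, cellPower η α Pmax Pbar (seenFrom z (markedPart X M true ω))
      (seenFrom z (markedPart X M false ω)) = ∑' m, if M m ω = false then
        (if ∀ k, M k ω = true → dist (X m ω) z ≤ dist (X m ω) (X k ω) then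
          ENNReal.ofReal (paPower η α Pmax Pbar (dist (X m ω) z)) else 0) else 0 := fun z => by
    -- For an embedding the change of variables needs no measurability of the integrand.
    have he : MeasurableEmbedding fun y : Plane => y - z :=
      (MeasurableEquiv.subRight z).measurableEmbedding
    rw [cellPower, ← lintegral_indicator (measurableSet_voronoiCell _ _)]
    conv_lhs => rw [seenFrom]
    rw [he.lintegral_map, lintegral_markedPart_eq_tsum]
    refine tsum_congr fun m => ?_
    simp only [Set.indicator_apply, sub_mem_voronoiCell_seenFrom, dist_zero_right, ← dist_eq_norm]
  rw [← lintegral_indicator hB, lintegral_markedPart_eq_tsum, ENNReal.tsum_prod']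
  refine tsum_congr fun n => ?_
  by_cases hn : M n ω = true
  · by_cases hnB : X n ω ∈ B
    · rw [if_pos hn, Set.indicator_of_mem hnB, hcell]
      refine tsum_congr fun m => ?_
      simp only [Set.indicator_apply, if_pos hnB, IsServedBy, Set.mem_ofPred_eq, hn, true_and]
      split_ifs <;> tauto
    · simp [hn, hnB, Set.indicator_apply]
  · simp [hn, IsServedBy]

lemma measurable_paPower (η α Pmax Pbar : ℝ) : Measurable (paPower η α Pmax Pbar) := by
  unfold paPower transmitPower
  fun_prop

lemma measurable_indicator_paPower (η α Pmax Pbar : ℝ) {B : Set Plane} (hB : MeasurableSet B) :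
    Measurable fun q : Plane × Plane =>
      B.indicator (fun z => ENNReal.ofReal (paPower η α Pmax Pbar (dist q.2 z))) q.1 := by
  have h : Measurable fun q : Plane × Plane =>
      ENNReal.ofReal (paPower η α Pmax Pbar (dist q.2 q.1)) :=
    ((measurable_paPower η α Pmax Pbar).comp (measurable_snd.dist measurable_fst)).ennreal_ofReal
  exact h.indicator (measurable_fst hB)

/-- Campbell's formula for pairs: mean and sum are exchanged by monotone convergence. -/
lemma IsIndependentMarking.lintegral_cellPower {Ω : Type*} [MeasurableSpace Ω] {μ : Measure Ω}
    {X : ℕ → Ω → Plane} {M : ℕ → Ω → Bool} {p : ℝ} (hM : IsIndependentMarking μ X M p)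
    (η α Pmax Pbar : ℝ) {B : Set Plane} (hB : MeasurableSet B) :
    ∫⁻ ω, ∫⁻ z in B, cellPower η α Pmax Pbar (seenFrom z (markedPart X M true ω))
        (seenFrom z (markedPart X M false ω)) ∂(markedPart X M true ω) ∂μ =
      ∫⁻ q, B.indicator (fun z => ENNReal.ofReal (paPower η α Pmax Pbar (dist q.2 z))) q.1
        ∂(servedPairMeasure μ X M) := by
  have hg := measurable_indicator_paPower η α Pmax Pbar hB
  have hX : ∀ q : ℕ × ℕ, Measurable fun ω => (X q.1 ω, X q.2 ω) := fun q =>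
    (hM.measurable_points _).prodMk (hM.measurable_points _)
  have hs : ∀ q : ℕ × ℕ, MeasurableSet {ω | IsServedBy X M q.1 q.2 ω} := fun q =>
    hM.measurableSet_isServedBy _ _
  simp_rw [setLIntegral_cellPower_eq_tsum X M η α Pmax Pbar hB]
  have hgX : ∀ q : ℕ × ℕ, Measurable fun ω => B.indicator
      (fun z => ENNReal.ofReal (paPower η α Pmax Pbar (dist (X q.2 ω) z))) (X q.1 ω) := fun q =>
    hg.comp (hX q)
  rw [lintegral_tsum fun q => ((hgX q).indicator (hs q)).aemeasurable,
    servedPairMeasure, lintegral_sum_measure]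
  refine tsum_congr fun q => ?_
  rw [lintegral_map hg (hX q), lintegral_indicator (hs q)]

/-! ### The radial integral. -/

section RadialIntegral

lemma integral_mul_exp_neg_mul_sq_Ioi {c : ℝ} (hc : 0 < c) (r : ℝ) :
    ∫ y in Set.Ioi r, y * Real.exp (-c * y ^ 2) = Real.exp (-(c * r ^ 2)) / (2 * c) := by
  have hd : ∀ y ∈ Set.Ici r, HasDerivAt (fun y => -(Real.exp (-c * y ^ 2) / (2 * c)))
      (y * Real.exp (-c * y ^ 2)) y := fun y _ => by
    have h := ((((hasDerivAt_pow 2 y).const_mul (-c)).exp).div_const (2 * c)).neg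
    refine h.congr_deriv ?_
    push_cast
    field_simp
  have hlim : Tendsto (fun y => -(Real.exp (-c * y ^ 2) / (2 * c))) atTop (𝓝 (-(0 / (2 * c)))) := by
    refine ((Real.tendsto_exp_atBot.comp ?_).div_const _).neg
    exact (tendsto_pow_atTop two_ne_zero).const_mul_atTop_of_neg (neg_neg_of_pos hc)
  rw [integral_Ioi_of_hasDerivAt_of_tendsto' hd (integrable_mul_exp_neg_mul_sq hc).integrableOn hlim,
    neg_mul]
  ring

/-- Substitution `t = c * y ^ 2`. -/
lemma integral_rpow_mul_exp_neg_mul_sq {c α : ℝ} (hc : 0 < c) (hα : 0 < α) {r : ℝ} (hr : 0 ≤ r) :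
    ∫ y in (0 : ℝ)..r, y * Real.exp (-c * y ^ 2) * y ^ α =
      lowerGamma (α / 2 + 1) (c * r ^ 2) / (2 * c ^ (1 + α / 2)) := by
  have hg : Continuous fun t : ℝ => t ^ (α / 2) * Real.exp (-t) :=
    (Real.continuous_rpow_const (by positivity)).mul (by fun_prop)
  have h := intervalIntegral.integral_comp_mul_deriv (a := 0) (b := r)
    (f := fun y => c * y ^ 2) (f' := fun y => c * (2 * y)) (g := fun t => t ^ (α / 2) * Real.exp (-t))
    (fun y _ => by simpa using (hasDerivAt_pow 2 y).const_mul c) (by fun_prop) hg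
  have hc' : c ^ (1 + α / 2) ≠ 0 := (Real.rpow_pos_of_pos hc _).ne'
  rw [lowerGamma, eq_div_iff (by positivity), ← intervalIntegral.integral_mul_const]
  simp only [add_sub_cancel_right]
  rw [show (0 : ℝ) = c * 0 ^ 2 by simp, ← h]
  simp only [ne_eq, OfNat.ofNat_ne_zero, not_false_eq_true, zero_pow, mul_zero]
  refine intervalIntegral.integral_congr fun y hy => ?_
  rw [Set.uIcc_of_le hr] at hy
  simp only [Function.comp]
  rw [Real.mul_rpow hc.le (sq_nonneg y), ← Real.rpow_natCast, ← Real.rpow_mul hy.1,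
    Real.rpow_add hc, Real.rpow_one, Real.rpow_natCast, neg_mul]
  rw [show ((2 : ℕ) : ℝ) * (α / 2) = α by push_cast; ring]
  ring

variable {η α Pmax Pbar : ℝ}

lemma paPower_nonneg (hη : 0 < η) (hPmax : 0 < Pmax) (hPbar : 0 < Pbar) {d : ℝ} (hd : 0 ≤ d) :
    0 ≤ paPower η α Pmax Pbar d := by
  unfold paPower transmitPower
  have := Real.rpow_nonneg hd α
  exact mul_nonneg (by positivity) (le_min hPmax.le (by positivity))

lemma paPower_le (hη : 0 < η) (d : ℝ) : paPower η α Pmax Pbar d ≤ η⁻¹ * Pmax :=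
  mul_le_mul_of_nonneg_left (min_le_left _ _) (by positivity)

lemma mul_criticalDistance_rpow (hα : 0 < α) (hPmax : 0 < Pmax) (hPbar : 0 < Pbar) :
    Pbar * criticalDistance α Pmax Pbar ^ α = Pmax := by
  rw [criticalDistance, ← Real.rpow_mul (by positivity), one_div_mul_cancel hα.ne', Real.rpow_one]
  field_simp

lemma integrableOn_mul_exp_mul_paPower (hη : 0 < η) (hPmax : 0 < Pmax) (hPbar : 0 < Pbar)
    {c : ℝ} (hc : 0 < c) :
    IntegrableOn (fun y => y * Real.exp (-c * y ^ 2) * paPower η α Pmax Pbar y) (Set.Ioi 0) := by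
  have hm : Measurable (paPower η α Pmax Pbar) := by
    unfold paPower transmitPower; fun_prop
  refine Integrable.mul_bdd (c := η⁻¹ * Pmax) (integrable_mul_exp_neg_mul_sq hc).integrableOn
    hm.aestronglyMeasurable ?_
  refine (ae_restrict_iff' measurableSet_Ioi).2 (ae_of_all _ fun y (hy : 0 < y) => ?_)
  rw [Real.norm_eq_abs, abs_of_nonneg (paPower_nonneg hη hPmax hPbar hy.le)]
  exact paPower_le hη y

/-- Up to the critical distance the minimum is the channel inversion term, which gives the
incomplete gamma function; beyond it the power is constant, which gives the exponential tail. -/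
lemma integral_mul_exp_mul_paPower (hη : 0 < η) (hα : 0 < α) (hPmax : 0 < Pmax) (hPbar : 0 < Pbar)
    {c : ℝ} (hc : 0 < c) :
    ∫ y in Set.Ioi 0, y * Real.exp (-c * y ^ 2) * paPower η α Pmax Pbar y =
      η⁻¹ * Pbar * (lowerGamma (α / 2 + 1) (c * criticalDistance α Pmax Pbar ^ 2) /
        (2 * c ^ (1 + α / 2))) +
      η⁻¹ * Pmax * (Real.exp (-(c * criticalDistance α Pmax Pbar ^ 2)) / (2 * c)) := by
  set r := criticalDistance α Pmax Pbar with hr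
  have hr0 : 0 ≤ r := Real.rpow_nonneg (by positivity) _
  have hPr : Pbar * r ^ α = Pmax := mul_criticalDistance_rpow hα hPmax hPbar
  have hI := integrableOn_mul_exp_mul_paPower (α := α) hη hPmax hPbar hc
  have hU : Set.Ioi (0 : ℝ) = Set.Ioc 0 r ∪ Set.Ioi r := (Set.Ioc_union_Ioi_eq_Ioi hr0).symm
  rw [hU, setIntegral_union (Set.Ioc_disjoint_Ioi le_rfl) measurableSet_Ioi
    (hI.mono_set Set.Ioc_subset_Ioi_self) (hI.mono_set (Set.Ioi_subset_Ioi hr0)),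
    ← integral_mul_exp_neg_mul_sq_Ioi hc, ← integral_rpow_mul_exp_neg_mul_sq hc hα hr0,
    intervalIntegral.integral_of_le hr0, ← integral_const_mul, ← integral_const_mul]
  congr 1
  · refine setIntegral_congr_fun measurableSet_Ioc fun y hy => ?_
    have : Pbar * y ^ α ≤ Pmax := by
      rw [← hPr]
      have := Real.rpow_le_rpow hy.1.le hy.2 hα.le
      gcongr
    simp only [paPower, transmitPower, min_eq_right this]
    ring
  · refine setIntegral_congr_fun measurableSet_Ioi fun y (hy : r < y) => ?_
    have : Pmax ≤ Pbar * y ^ α := by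
      rw [← hPr]
      have := Real.rpow_le_rpow hr0 hy.le hα.le
      gcongr
    simp only [paPower, transmitPower, min_eq_left this]
    ring

/-- Polar coordinates. The factor `a` is kept outside because it is the aggregator density that the
Palm quotient cancels. -/
lemma lintegral_exp_mul_paPower (hη : 0 < η) (hα : 0 < α) (hPmax : 0 < Pmax) (hPbar : 0 < Pbar)
    {a b : ℝ} (ha : 0 < a) (hb : 0 ≤ b) :
    ∫⁻ x : Plane, ENNReal.ofReal (a * b * Real.exp (-(a * Real.pi * ‖x‖ ^ 2))) *
        ENNReal.ofReal (paPower η α Pmax Pbar ‖x‖) =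
      ENNReal.ofReal (a * (Real.pi * b * Pbar / (η * (Real.pi * a) ^ (1 + α / 2)) *
            lowerGamma (α / 2 + 1) (a * Real.pi * criticalDistance α Pmax Pbar ^ 2) +
          b * Pmax / (η * a) *
            Real.exp (-(a * Real.pi * criticalDistance α Pmax Pbar ^ 2)))) := by
  have hc : 0 < a * Real.pi := by positivity
  have hball : volume.real (Metric.ball (0 : Plane) 1) = Real.pi := by
    rw [measureReal_def, EuclideanSpace.volume_ball_fin_two]
    simp [Real.pi_pos.le]
  set F : ℝ → ℝ := fun y => a * b * Real.exp (-(a * Real.pi * y ^ 2)) * paPower η α Pmax Pbar y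
  have hF : ∀ y, y ^ (Module.finrank ℝ Plane - 1) • F y =
      a * b * (y * Real.exp (-(a * Real.pi) * y ^ 2) * paPower η α Pmax Pbar y) := fun y => by
    simp only [finrank_euclideanSpace, Fintype.card_fin, F, smul_eq_mul, neg_mul]
    ring
  have hint : Integrable fun x : Plane => F ‖x‖ := by
    rw [integrable_fun_norm_addHaar]
    simp_rw [hF]
    exact (integrableOn_mul_exp_mul_paPower hη hPmax hPbar hc).const_mul _
  have hnn : ∀ x : Plane, 0 ≤ F ‖x‖ := fun x =>
    mul_nonneg (by positivity) (paPower_nonneg hη hPmax hPbar (norm_nonneg x))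
  have h1 : ∀ x : Plane, ENNReal.ofReal (a * b * Real.exp (-(a * Real.pi * ‖x‖ ^ 2))) *
        ENNReal.ofReal (paPower η α Pmax Pbar ‖x‖) = ENNReal.ofReal (F ‖x‖) := fun x => by
    rw [← ENNReal.ofReal_mul (by positivity)]
  simp_rw [h1]
  rw [← ofReal_integral_eq_lintegral_ofReal hint (ae_of_all _ hnn), integral_fun_norm_addHaar]
  simp_rw [hF]
  rw [integral_const_mul, integral_mul_exp_mul_paPower hη hα hPmax hPbar hc, hball,
    finrank_euclideanSpace, Fintype.card_fin, mul_comm Real.pi a]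
  have : (a * Real.pi) ^ (1 + α / 2) ≠ 0 := (Real.rpow_pos_of_pos hc _).ne'
  congr 1
  simp only [smul_eq_mul, nsmul_eq_mul]
  push_cast
  field_simp

end RadialIntegral

/-! ### The mean consumption in the typical cell. -/

theorem theorem1 {Ω : Type*} [MeasurableSpace Ω] (μ : Measure Ω) [IsProbabilityMeasure μ]
    (X : ℕ → Ω → Plane) (M : ℕ → Ω → Bool)
    (lam p lamA lamU η α Pmax Pbar : ℝ)
    (hlam : 0 < lam) (hp : 0 < p) (hp1 : p ≤ 1)
    (hlamA : lamA = p * lam) (hlamU : lamU = (1 - p) * lam)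
    (hη : 0 < η) (hα : 0 < α) (hPmax : 0 < Pmax) (hPbar : 0 < Pbar)
    (hX : IsPoissonProcess μ (pointProcess X) lam)
    (hM : IsIndependentMarking μ X M p)
    (B : Set Plane) (hB : MeasurableSet B) (hB0 : volume B ≠ 0) (hB1 : volume B ≠ ⊤) :
    palmExpectation μ (markedPart X M true) (markedPart X M false) B
        (cellPower η α Pmax Pbar) =
      ENNReal.ofReal
        (Real.pi * lamU * Pbar / (η * (Real.pi * lamA) ^ (1 + α / 2)) *
            lowerGamma (α / 2 + 1) (lamA * Real.pi * criticalDistance α Pmax Pbar ^ 2) +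
          lamU * Pmax / (η * lamA) *
            Real.exp (-(lamA * Real.pi * criticalDistance α Pmax Pbar ^ 2))) := by

  subst hlamA hlamU
  have hq := sub_nonneg.2 hp1
  have ha : 0 < p * lam := by positivity
  have hb : 0 ≤ (1 - p) * lam := by positivity
  set V : ENNReal := ENNReal.ofReal (Real.pi * ((1 - p) * lam) * Pbar /
    (η * (Real.pi * (p * lam)) ^ (1 + α / 2)) *
      lowerGamma (α / 2 + 1) (p * lam * Real.pi * criticalDistance α Pmax Pbar ^ 2) +
      (1 - p) * lam * Pmax / (η * (p * lam)) *
        Real.exp (-(p * lam * Real.pi * criticalDistance α Pmax Pbar ^ 2))) with hV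
  have hk : Measurable fun q : Plane × Plane =>
      servedPairDensity (p * lam) ((1 - p) * lam) (dist q.1 q.2) :=
    ((continuous_servedPairDensity _ _).comp continuous_dist).measurable
  have hg := measurable_indicator_paPower η α Pmax Pbar hB
  -- Translation invariance moves the aggregator to the origin, so the value does not depend on `z`.
  have hinner : ∀ z : Plane, ∫⁻ x, servedPairDensity (p * lam) ((1 - p) * lam) (dist z x) *
      ENNReal.ofReal (paPower η α Pmax Pbar (dist x z)) = ENNReal.ofReal (p * lam) * V := fun z => by
    rw [hV, ← ENNReal.ofReal_mul ha.le,
      ← lintegral_exp_mul_paPower hη hα hPmax hPbar ha hb, ← lintegral_add_right_eq_self _ z]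
    refine lintegral_congr fun x => ?_
    rw [servedPairDensity, dist_comm z (x + z), dist_eq_norm, add_sub_cancel_right,
      max_eq_left (norm_nonneg _)]
  rw [palmExpectation, hM.lintegral_cellPower η α Pmax Pbar hB,
    hM.servedPairMeasure_eq_withDensity hX hlam.le hp.le hp1,
    hM.lintegral_markedPart hX hlam.le hB hB1, lintegral_withDensity_eq_lintegral_mul _ hk hg,
    lintegral_prod _ (hk.mul hg).aemeasurable]
  have houter : ∀ z : Plane, ∫⁻ x, ((fun q : Plane × Plane =>
        servedPairDensity (p * lam) ((1 - p) * lam) (dist q.1 q.2)) * fun q : Plane × Plane =>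
      B.indicator (fun z => ENNReal.ofReal (paPower η α Pmax Pbar (dist q.2 z))) q.1) (z, x) =
      B.indicator (fun _ => ENNReal.ofReal (p * lam) * V) z := fun z => by
    by_cases hz : z ∈ B
    · rw [Set.indicator_of_mem hz, ← hinner z]
      refine lintegral_congr fun x => ?_
      simp only [Pi.mul_apply, Set.indicator_of_mem hz]
    · simp [hz]
  simp_rw [houter]
  -- The mean number of aggregators in `B` cancels, being neither zero nor infinite.
  rw [lintegral_indicator hB, setLIntegral_const, ← mul_assoc, ← ENNReal.ofReal_mul hp.le,
    mul_right_comm, mul_comm _ V, ENNReal.mul_div_cancel_right]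
  · exact mul_ne_zero (by simpa using ha) hB0
  · exact ENNReal.mul_ne_top ENNReal.ofReal_ne_top hB1
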